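/- **Theorem (first no-hair theorem).** Let $\mathfrak g$ be a three-dimensional real solvable Lie algebra (equivalently, of one of the Bianchi types I–VII$_h$), $G$ a Lie group with Lie algebra $\mathfrak g$, and consider on $(t_0,\infty)\times G$ a spatially homogeneous metric $$ds^2=-dt^2+\delta_{ab}\,\omega^a\omega^b ,$$ where, for each $t$, $(\omega^a)$ is the coframe dual to a basis $e_1(t),e_2(t),e_3(t)$ of left-invariant vector fields on $G$ that depends on $t$ in a $C^2$ way; put $e_0=\partial_t$. Let $j\in\{1,3\}$, $\gamma\ge 0$ and $\Lambda>0$. Suppose that for all $t>t_0$ the Einstein equations (with $8\pi G=c=1$) $$R_{\mu\nu}-\tfrac12 R\,g_{\mu\nu}=T^{\rm pf}_{\mu\nu}+T^{\rm jf}_{\mu\nu}-\Lambda g_{\mu\nu}$$ hold, where all matter fields are $C^1$ and homogeneous (their components in the frame $(e_\mu)$ depend on $t$ only), and * $T^{\rm jf}_{\mu\nu}=\frac{1}{(j-1)!}\mathcal P_{\mu\alpha_2\cdots\alpha_j}\mathcal P_{\nu}{}^{\alpha_2\cdots\alpha_j}-\frac{1}{2\,j!}\,g_{\mu\nu}\,\mathcal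 P_{\alpha_1\cdots\alpha_j}\mathcal P^{\alpha_1\cdots\alpha_j}$ is the energy-momentum tensor of a $j$-form $\mathcal P$ with $d\mathcal P=0$ and $d{\star}\mathcal P=0$; * $T^{\rm pf}_{\mu\nu}=(\rho+p)U_\mu U_\nu+p\,g_{\mu\nu}$ is that of a perfect fluid with $p=(\gamma-1)\rho$, $\rho\ge0$, $U_\mu U^\mu=-1$ ($U=e_0$ or not), which does not interact with the other matter: $\nabla^\mu T^{\rm pf}_{\mu\nu}=0$. Let $H=\frac13\nabla_\mu e_0{}^\mu$ be the Hubble parameter, $\sigma_{ab}$ the shear of the observers $e_0$ (the trace-free part of $\nabla_a (e_0)_b$), $q$ the deceleration parameter, $\dot H=-(1+q)H^2$, and $\Omega_\Lambda=\Lambda/(3H^2)$, $\Omega_{\rm pf}=T^{\rm pf}(e_0,e_0)/(3H^2)$. Then the space-time is asymptotically de Sitter: as $t\to\infty$, the components $R_{\rho\sigma\mu\nu}$ of the Riemann tensor in the orthonormal frame $(e_\mu)$ tend to $K(g_{\rho\mu}g_{\sigma\nu}-g_{\rho\nu}g_{\sigma\mu})$ for some constant $K>0$, $\sigma_{ab}/H\to0$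 and $q\to-1$. Moreover $\Omega_\Lambda\to1$ if $\gamma>0$, and $\Omega_\Lambda+\Omega_{\rm pf}\to1$ if $\gamma=0$. -/

import Mathlib

/-!
Spatially homogeneous space-times `(t₀, ∞) × G`, `G` a three-dimensional Lie group with Lie
algebra `𝔤`, are described by an orthonormal frame `e₀ = ∂/∂t`, `e₁, e₂, e₃`, where for each `t`
the left-invariant spatial vectors `e₁(t), e₂(t), e₃(t)` form a basis of `𝔤`. The metric is the
one for which the frame is orthonormal, `ds² = - dt² + δ_ab ω^a ω^b` with `ω^a` the dual coframe.
Homogeneous tensor fields have frame components that depend on `t` only. Space-time indices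
are elements of `Fin 4`, with `0` the time index; spatial indices `a : Fin 3` enter as `a.succ`.
-/

open Filter Topology

namespace Bianchi

noncomputable section

/-- The diagonal entries of the Minkowski metric, signature `(-,+,+,+)`. -/
def etaDiag : Fin 4 → ℝ := ![-1, 1, 1, 1]

/-- The frame components `g_{μν}` (and `g^{μν}`) of the metric in the orthonormal frame. -/
def eta (μ ν : Fin 4) : ℝ := if μ = ν then etaDiag μ else 0

section Geometry

variable {𝔤 : Type*} [LieRing 𝔤] [LieAlgebra ℝ 𝔤]

/-- `γ^a_{0b}`, given by `[e₀, e_b] = ∂_t e_b = γ^a_{0b} e_a`. -/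
def timeCoeff (e : ℝ → Module.Basis (Fin 3) ℝ 𝔤) (t : ℝ) (a b : Fin 3) : ℝ :=
  deriv (fun s => (e t).coord a (e s b)) t

/-- `γ^a_{bc}`, given by `[e_b, e_c] = γ^a_{bc} e_a`. -/
def spaceCoeff (e : ℝ → Module.Basis (Fin 3) ℝ 𝔤) (t : ℝ) (a b c : Fin 3) : ℝ :=
  (e t).coord a ⁅e t b, e t c⁆

/-- The commutation functions `γ^ρ_{μν}` of the space-time frame,
`[e_μ, e_ν] = γ^ρ_{μν} e_ρ`. -/
def commCoeff (e : ℝ → Module.Basis (Fin 3) ℝ 𝔤) (t : ℝ) (ρ μ ν : Fin 4) : ℝ :=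
  Fin.cases (motive := fun _ => ℝ) 0
    (fun a => Fin.cases (motive := fun _ => ℝ)
      (Fin.cases (motive := fun _ => ℝ) 0 (fun b => timeCoeff e t a b) ν)
      (fun b => Fin.cases (motive := fun _ => ℝ) (-timeCoeff e t a b)
        (fun c => spaceCoeff e t a b c) ν) μ) ρ

/-- The frame derivative `e_μ(f)` of a homogeneous function `f`. -/
def frameDeriv (μ : Fin 4) (f : ℝ → ℝ) (t : ℝ) : ℝ := if μ = 0 then deriv f t else 0

/-- The Levi-Civita connection, `∇_{e_μ} e_ν = Γ^λ_{μν} e_λ` with `Γ^λ_{μν} = conn e t λ μ ν`,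
from the Koszul formula in an orthonormal frame. -/
def conn (e : ℝ → Module.Basis (Fin 3) ℝ 𝔤) (t : ℝ) (l μ ν : Fin 4) : ℝ :=
  (commCoeff e t l μ ν
    - etaDiag l * (etaDiag ν * commCoeff e t ν μ l + etaDiag μ * commCoeff e t μ ν l)) / 2

/-- The Riemann tensor, `R(e_μ, e_ν) e_σ = R^ρ_{σμν} e_ρ`, where
`R(X, Y) = ∇_X ∇_Y - ∇_Y ∇_X - ∇_{[X, Y]}`. -/
def riemann (e : ℝ → Module.Basis (Fin 3) ℝ 𝔤) (t : ℝ) (ρ σ μ ν : Fin 4) : ℝ :=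
  frameDeriv μ (fun s => conn e s ρ ν σ) t - frameDeriv ν (fun s => conn e s ρ μ σ) t
    + ∑ l, (conn e t ρ μ l * conn e t l ν σ - conn e t ρ ν l * conn e t l μ σ
      - commCoeff e t l μ ν * conn e t ρ l σ)

/-- The Ricci tensor `R_{σν} = R^ρ_{σρν}`. -/
def ricci (e : ℝ → Module.Basis (Fin 3) ℝ 𝔤) (t : ℝ) (σ ν : Fin 4) : ℝ :=
  ∑ ρ, riemann e t ρ σ ρ ν

/-- The Ricci scalar. -/
def scalarCurv (e : ℝ → Module.Basis (Fin 3) ℝ 𝔤) (t : ℝ) : ℝ :=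
  ∑ μ, etaDiag μ * ricci e t μ μ

/-- The Einstein tensor `R_{μν} - R g_{μν} / 2`. -/
def einstein (e : ℝ → Module.Basis (Fin 3) ℝ 𝔤) (t : ℝ) (μ ν : Fin 4) : ℝ :=
  ricci e t μ ν - scalarCurv e t * eta μ ν / 2

/-- The covariant derivative `(∇_α S)_{m₁ … m_n}` of a homogeneous covariant tensor field `S`
of rank `n`. -/
def covDeriv (e : ℝ → Module.Basis (Fin 3) ℝ 𝔤) {n : ℕ} (S : ℝ → (Fin n → Fin 4) → ℝ)
    (t : ℝ) (α : Fin 4) (m : Fin n → Fin 4) : ℝ :=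
  frameDeriv α (fun s => S s m) t
    - ∑ k, ∑ l, conn e t l α (m k) * S t (Function.update m k l)

/-- The divergence `∇^α S_{α m₁ … m_n}`. -/
def divergence (e : ℝ → Module.Basis (Fin 3) ℝ 𝔤) {n : ℕ}
    (S : ℝ → (Fin (n + 1) → Fin 4) → ℝ) (t : ℝ) (m : Fin n → Fin 4) : ℝ :=
  ∑ α, etaDiag α * covDeriv e S t α (Fin.cons α m)

/-- The exterior derivative of a form `P` of degree `n`,
`(dP)_{m₀ … m_n} = ∑ₖ (-1)^k (∇_{m_k} P)_{m₀ … m̂_k … m_n}`, i.e. `(n + 1) ∇_{[m₀} P_{m₁ … m_n]}`. -/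
def extDeriv (e : ℝ → Module.Basis (Fin 3) ℝ 𝔤) {n : ℕ} (P : ℝ → (Fin n → Fin 4) → ℝ)
    (t : ℝ) (m : Fin (n + 1) → Fin 4) : ℝ :=
  ∑ k : Fin (n + 1), (-1) ^ (k : ℕ) * covDeriv e P t (m k) (fun i => m (k.succAbove i))

/-- The Hubble parameter `H = ∇_μ u^μ / 3` of the observers `u = e₀`. -/
def hubble (e : ℝ → Module.Basis (Fin 3) ℝ 𝔤) (t : ℝ) : ℝ :=
  (∑ μ, conn e t μ μ 0) / 3

/-- The shear `σ_{ab}` of the observers `u = e₀`: the trace-free part of `∇_a u_b`, which is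
symmetric since the space-time is hypersurface-orthogonal to `u`. -/
def shear (e : ℝ → Module.Basis (Fin 3) ℝ 𝔤) (t : ℝ) (a b : Fin 3) : ℝ :=
  conn e t b.succ a.succ 0 - (if a = b then hubble e t else 0)

/-- The deceleration parameter, defined by `dH/dt = -(1 + q) H²`. -/
def deceleration (e : ℝ → Module.Basis (Fin 3) ℝ 𝔤) (t : ℝ) : ℝ :=
  -1 - deriv (hubble e) t / hubble e t ^ 2

/-- The space-time is asymptotically de Sitter: in the orthonormal frame the Riemann tensor
`R_{ρσμν}` tends to that of a de Sitter space-time, `K (g_{ρμ} g_{σν} - g_{ρν} g_{σμ})` with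
`K > 0`, the Hubble-normalized shear of the observers `e₀` tends to `0` and the deceleration
parameter tends to `-1`. -/
def AsymptoticallyDeSitter (e : ℝ → Module.Basis (Fin 3) ℝ 𝔤) : Prop :=
  (∃ K : ℝ, 0 < K ∧ ∀ ρ σ μ ν : Fin 4,
    Tendsto (fun t => etaDiag ρ * riemann e t ρ σ μ ν) atTop
      (𝓝 (K * (eta ρ μ * eta σ ν - eta ρ ν * eta σ μ)))) ∧
  (∀ a b : Fin 3, Tendsto (fun t => shear e t a b / hubble e t) atTop (𝓝 0)) ∧
  Tendsto (deceleration e) atTop (𝓝 (-1))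

end Geometry

section Matter

/-- The energy-momentum tensor of a form field strength `P` of degree `q + 1` with action
`-1/2 ∫ P ∧ ⋆P`:
`T_{μν} = (1/q!) P_{μ α₁ … α_q} P_ν^{α₁ … α_q} - (1/(2 (q+1)!)) g_{μν} P_{α₀ … α_q} P^{α₀ … α_q}`.
For `q = 0` this is `J_μ J_ν - g_{μν} J_α J^α / 2`. -/
def formT {q : ℕ} (P : ℝ → (Fin (q + 1) → Fin 4) → ℝ) (t : ℝ) (μ ν : Fin 4) : ℝ :=
  (1 / (Nat.factorial q : ℝ)) * (∑ n : Fin q → Fin 4,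
      (∏ i, etaDiag (n i)) * (P t (Fin.cons μ n) * P t (Fin.cons ν n)))
    - (1 / (2 * (Nat.factorial (q + 1) : ℝ))) * eta μ ν *
      ∑ m : Fin (q + 1) → Fin 4, (∏ i, etaDiag (m i)) * P t m ^ 2

/-- The energy-momentum tensor `(ρ + p) U_μ U_ν + p g_{μν}`, `p = (γ - 1) ρ`, of a perfect
fluid with energy density `ρ` and four-velocity `U^μ`. -/
def fluidT (γ : ℝ) (ρ : ℝ → ℝ) (U : ℝ → Fin 4 → ℝ) (t : ℝ) (μ ν : Fin 4) : ℝ :=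
  γ * ρ t * ((etaDiag μ * U t μ) * (etaDiag ν * U t ν)) + (γ - 1) * ρ t * eta μ ν

end Matter

section Model

variable {𝔤 : Type*} [LieRing 𝔤] [LieAlgebra ℝ 𝔤]

/-- The space-time with orthonormal frame `e`, a form field strength `P` of degree `q + 1`, a
perfect fluid `(ρ, U)` with equation of state `p = (γ - 1) ρ` and the cosmological constant `Λ`
solve the Einstein equations (with `8πG = c = 1`) for `t > t₀`; the form field obeys its free
field equations and the fluid does not interact with the other matter. -/
structure IsCosmology (γ Λ t₀ : ℝ) {q : ℕ} (e : ℝ → Module.Basis (Fin 3) ℝ 𝔤)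
    (P : ℝ → (Fin (q + 1) → Fin 4) → ℝ) (ρ : ℝ → ℝ) (U : ℝ → Fin 4 → ℝ) : Prop where
  frame_contDiff : ∀ (φ : Module.Dual ℝ 𝔤) (a : Fin 3),
    ContDiffOn ℝ 2 (fun t => φ (e t a)) (Set.Ioi t₀)
  form_contDiff : ∀ m, ContDiffOn ℝ 1 (fun t => P t m) (Set.Ioi t₀)
  density_contDiff : ContDiffOn ℝ 1 ρ (Set.Ioi t₀)
  velocity_contDiff : ∀ μ, ContDiffOn ℝ 1 (fun t => U t μ) (Set.Ioi t₀)
  form_alternating : ∀ t > t₀, ∀ (m : Fin (q + 1) → Fin 4) (s : Equiv.Perm (Fin (q + 1))),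
    P t (m ∘ s) = ((Equiv.Perm.sign s : ℤ) : ℝ) * P t m
  form_closed : ∀ t > t₀, ∀ m, extDeriv e P t m = 0
  form_coclosed : ∀ t > t₀, ∀ m, divergence e P t m = 0
  density_nonneg : ∀ t > t₀, 0 ≤ ρ t
  velocity_unit : ∀ t > t₀, ∑ μ, etaDiag μ * U t μ ^ 2 = -1
  fluid_conserved : ∀ t > t₀, ∀ m,
    divergence e (n := 1) (fun s i => fluidT γ ρ U s (i 0) (i 1)) t m = 0
  einstein_eq : ∀ t > t₀, ∀ μ ν,
    einstein e t μ ν = fluidT γ ρ U t μ ν + formT P t μ ν - Λ * eta μ ν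

/-- `Ω_Λ = Λ / (3 H²)`. -/
def omegaLambda (Λ : ℝ) (e : ℝ → Module.Basis (Fin 3) ℝ 𝔤) (t : ℝ) : ℝ :=
  Λ / (3 * hubble e t ^ 2)

/-- `Ω_pf`, the energy density of the fluid relative to the observers `e₀`, divided by `3 H²`.
It is `ρ / (3 H²)` if the fluid is comoving with them. -/
def omegaFluid (γ : ℝ) (ρ : ℝ → ℝ) (U : ℝ → Fin 4 → ℝ) (e : ℝ → Module.Basis (Fin 3) ℝ 𝔤)
    (t : ℝ) : ℝ :=
  fluidT γ ρ U t 0 0 / (3 * hubble e t ^ 2)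

end Model

end

end Bianchi

/-!
The argument is Wald's. With `σ²` the square of the shear and `T` the energy-momentum tensor of the
matter, the Friedmann and Raychaudhuri equations read
`3 H² - Λ = T₀₀ + σ² / 2 - ³R / 2` and `3 dH/dt = Λ - 3 H² - σ² - T₀₀ - T^μ_μ / 2`. On a solvable
Lie algebra `³R ≤ 0`, and the matter satisfies the dominant energy condition and a uniform strong
energy condition, so that `H² ≥ Λ / 3` and `dH/dt ≤ -κ (H² - Λ / 3)` for some `0 < κ ≤ 1`. Hence
either `H → √(Λ / 3)`, or `H = -√(Λ / 3)` from some time on. By the Friedmann equation shear and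
matter die out (in the second case they vanish). In the first case the expansion makes the
structure constants decay exponentially, and with them the curvature of the group; in the second
case the Einstein equations force the group to be flat. In both cases the Riemann tensor tends to
that of de Sitter space.

A fluid with `γ = 0` has constant energy density and only shifts `Λ`.
-/

namespace Bianchi

section Preliminaries

lemma sum_kernelProjection_sq {n : Type*} [Fintype n] [DecidableEq n] (v : n → ℝ) :
    ∑ i, ∑ j, ((if i = j then v ⬝ᵥ v else 0) - v i * v j) ^ 2 =
      (Fintype.card n - 1) * (v ⬝ᵥ v) ^ 2 := by
  have hv : ∑ i, ∑ j, (v i * v j) ^ 2 = (v ⬝ᵥ v) ^ 2 := by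
    simp only [mul_pow, ← Finset.sum_mul_sum, dotProduct, ← sq]
  have hdiag : ∑ i, 2 * (v ⬝ᵥ v) * (v i * v i) = 2 * (v ⬝ᵥ v) ^ 2 := by
    rw [← Finset.mul_sum, ← dotProduct]
    ring
  simp only [sub_sq, Finset.sum_add_distrib, Finset.sum_sub_distrib, hv, ite_pow, mul_ite, ite_mul,
    zero_mul, mul_zero, ne_eq, OfNat.ofNat_ne_zero, not_false_eq_true, zero_pow, Finset.sum_ite_eq,
    Finset.mem_univ, if_true, hdiag, Finset.sum_const, Finset.card_univ, nsmul_eq_mul]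
  ring

/- If `v` is a unit vector in the kernel of `A`, then `tr A` is the Frobenius inner product of `A`
with the projection `1 - v vᵀ`, which has squared norm `card n - 1`. -/
lemma sq_trace_le_of_mulVec_eq_zero {n : Type*} [Fintype n] {A : Matrix n n ℝ} {v : n → ℝ}
    (hv : v ≠ 0) (hA : A.mulVec v = 0) :
    A.trace ^ 2 ≤ (Fintype.card n - 1) * ∑ i, ∑ j, A i j ^ 2 := by
  classical
  have hv0 : 0 < v ⬝ᵥ v := by
    simpa using Matrix.dotProduct_star_self_pos_iff.2 hv
  have htrace : ∑ i, ∑ j, A i j * ((if i = j then v ⬝ᵥ v else 0) - v i * v j) =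
      (v ⬝ᵥ v) * A.trace := by
    have hrow (i : n) : ∑ j, A i j * (v i * v j) = v i * A.mulVec v i := by
      rw [Matrix.mulVec, dotProduct, Finset.mul_sum]
      exact Finset.sum_congr rfl fun j _ => by ring
    simp only [mul_sub, Finset.sum_sub_distrib, hrow, hA, mul_ite, mul_zero, Finset.sum_ite_eq,
      Finset.mem_univ, if_true, Pi.zero_apply, sub_zero, Matrix.trace,
      Matrix.diag, ← Finset.sum_mul, mul_comm]
  have hcs := Finset.sum_mul_sq_le_sq_mul_sq Finset.univ (fun x : n × n => A x.1 x.2)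
    (fun x => (if x.1 = x.2 then v ⬝ᵥ v else 0) - v x.1 * v x.2)
  simp only [Fintype.sum_prod_type, htrace, sum_kernelProjection_sq] at hcs
  refine le_of_mul_le_mul_left ?_ (pow_pos hv0 2)
  linarith

lemma abs_mul_le_half_add_sq (x y : ℝ) : |x * y| ≤ (x ^ 2 + y ^ 2) / 2 := by
  rw [abs_mul, ← sq_abs x, ← sq_abs y]
  linarith [two_mul_le_add_sq |x| |y|]

section MatrixCalculus

variable {E 𝕜 n : Type*} [NontriviallyNormedField 𝕜] [NormedAddCommGroup E] [NormedSpace 𝕜 E]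
  [Fintype n] [DecidableEq n] {k : WithTop ℕ∞} {A : E → Matrix n n 𝕜} {x : E}

lemma contDiffAt_matrix_det (hA : ∀ i j, ContDiffAt 𝕜 k (fun y => A y i j) x) :
    ContDiffAt 𝕜 k (fun y => (A y).det) x := by
  simp only [Matrix.det_apply']
  exact ContDiffAt.sum fun σ _ => contDiffAt_const.mul (contDiffAt_prod fun i _ => hA _ _)

lemma contDiffAt_matrix_adjugate (hA : ∀ i j, ContDiffAt 𝕜 k (fun y => A y i j) x) (i j : n) :
    ContDiffAt 𝕜 k (fun y => (A y).adjugate i j) x := by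
  simp only [Matrix.adjugate_apply]
  refine contDiffAt_matrix_det fun p r => ?_
  simp only [Matrix.updateRow_apply]
  split_ifs
  · exact contDiffAt_const
  · exact hA p r

lemma contDiffAt_matrix_inv (hA : ∀ i j, ContDiffAt 𝕜 k (fun y => A y i j) x)
    (hx : (A x).det ≠ 0) (i j : n) : ContDiffAt 𝕜 k (fun y => (A y)⁻¹ i j) x := by
  simp only [Matrix.inv_def, Matrix.smul_apply, smul_eq_mul, Ring.inverse_eq_inv']
  exact ((contDiffAt_matrix_det hA).inv hx).mul (contDiffAt_matrix_adjugate hA i j)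

end MatrixCalculus

section DifferentialInequalities

variable {f f' : ℝ → ℝ} {t₀ k κ : ℝ}

lemma antitoneOn_Ioi_of_hasDerivAt_nonpos (hf : ∀ t > t₀, HasDerivAt f (f' t) t)
    (hle : ∀ t > t₀, f' t ≤ 0) : AntitoneOn f (Set.Ioi t₀) := by
  refine antitoneOn_of_hasDerivWithinAt_nonpos (convex_Ioi t₀)
    (fun t ht => (hf t ht).continuousAt.continuousWithinAt) (f' := f') ?_ ?_
  all_goals simp only [interior_Ioi, Set.mem_Ioi]
  · exact fun t ht => (hf t ht).hasDerivWithinAt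
  · exact hle

lemma tendsto_zero_of_deriv_le_neg_mul (hκ : 0 < κ) (hf : ∀ t > t₀, HasDerivAt f (f' t) t)
    (hle : ∀ t > t₀, f' t ≤ -κ * f t) (h0 : ∀ t > t₀, 0 ≤ f t) : Tendsto f atTop (𝓝 0) := by
  have hanti : AntitoneOn (fun t => f t * Real.exp (κ * t)) (Set.Ioi t₀) :=
    antitoneOn_Ioi_of_hasDerivAt_nonpos
      (fun t ht => (hf t ht).mul (((hasDerivAt_id t).const_mul κ).exp)) fun t ht => by
        have := mul_le_mul_of_nonneg_right (hle t ht) (Real.exp_pos (κ * t)).le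
        simp only [id_eq]
        linarith
  set A := f (t₀ + 1) * Real.exp (κ * (t₀ + 1))
  have hlim : Tendsto (fun t => A * Real.exp (-(κ * t))) atTop (𝓝 0) := by
    simpa using (Real.tendsto_exp_neg_atTop_nhds_zero.comp
      (tendsto_id.const_mul_atTop hκ)).const_mul A
  refine squeeze_zero' ((eventually_gt_atTop t₀).mono h0) ?_ hlim
  filter_upwards [eventually_ge_atTop (t₀ + 1)] with t ht
  rw [Real.exp_neg, ← div_eq_mul_inv, le_div_iff₀ (Real.exp_pos _)]
  exact hanti (Set.mem_Ioi.2 (by linarith)) (Set.mem_Ioi.2 (by linarith)) ht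

/- `1 / f + κ t` is nonincreasing, so `1 / f` becomes negative in finite time. -/
lemma not_forall_mul_sq_le_deriv (hκ : 0 < κ) (hf : ∀ t > t₀, HasDerivAt f (f' t) t)
    (h0 : ∀ t > t₀, 0 < f t) : ¬ ∀ t > t₀, κ * f t ^ 2 ≤ f' t := by
  intro hle
  have hanti : AntitoneOn (fun t => (f t)⁻¹ + κ * t) (Set.Ioi t₀) :=
    antitoneOn_Ioi_of_hasDerivAt_nonpos (fun t ht =>
      ((hf t ht).fun_inv (h0 t ht).ne').add ((hasDerivAt_id t).const_mul κ)) fun t ht => by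
        have := (le_div_iff₀ (pow_pos (h0 t ht) 2)).2 (hle t ht)
        rw [neg_div]
        linarith
  have hpos : 0 < (f (t₀ + 1))⁻¹ := inv_pos.2 (h0 _ (by linarith))
  set s := t₀ + 1 + (f (t₀ + 1))⁻¹ / κ with hs
  have ht₀s : t₀ + 1 ≤ s := by linarith [div_pos hpos hκ]
  have hκs : κ * s = κ * (t₀ + 1) + (f (t₀ + 1))⁻¹ := by
    rw [hs]
    field_simp
  have hle_s : (f s)⁻¹ + κ * s ≤ (f (t₀ + 1))⁻¹ + κ * (t₀ + 1) :=
    hanti (Set.mem_Ioi.2 (by linarith)) (Set.mem_Ioi.2 (by linarith)) ht₀s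
  have : 0 < (f s)⁻¹ := inv_pos.2 (h0 _ (by linarith))
  linarith

lemma tendsto_of_deriv_le_of_le (hκ : 0 < κ) (hk : 0 < k)
    (hf : ∀ t > t₀, HasDerivAt f (f' t) t) (hle : ∀ t > t₀, f' t ≤ -(κ * (f t ^ 2 - k ^ 2)))
    (hge : ∀ t > t₀, k ≤ f t) : Tendsto f atTop (𝓝 k) := by
  have hlim : Tendsto (fun t => f t - k) atTop (𝓝 0) :=
    tendsto_zero_of_deriv_le_neg_mul (κ := κ * (2 * k)) (by positivity)
      (fun t ht => (hf t ht).sub_const k)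
      (fun t ht => by
        have : 0 ≤ κ * (f t - k) ^ 2 := by positivity
        linarith [hle t ht])
      (fun t ht => sub_nonneg.2 (hge t ht))
  simpa using hlim.add_const k

/- Below `-k` the function `y = -f - k` satisfies `dy/dt ≥ κ y²`, which has no global positive
solution. -/
lemma not_lt_neg_of_deriv_le (hκ : 0 < κ) (hk : 0 < k) (hf : ∀ t > t₀, HasDerivAt f (f' t) t)
    (hle : ∀ t > t₀, f' t ≤ -(κ * (f t ^ 2 - k ^ 2))) : ¬ ∀ t > t₀, f t < -k := by
  intro hlt
  refine not_forall_mul_sq_le_deriv hκ (f := fun t => -f t - k)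
    (fun t ht => (hf t ht).neg.sub_const k) (fun t ht => by linarith [hlt t ht]) fun t ht => ?_
  have : 0 ≤ κ * (k * (-f t - k)) :=
    mul_nonneg hκ.le (mul_nonneg hk.le (by linarith [hlt t ht]))
  linarith [hle t ht]

lemma tendsto_or_eventually_eq_neg_of_deriv_le (hκ : 0 < κ) (hk : 0 < k)
    (hf : ∀ t > t₀, HasDerivAt f (f' t) t) (hle : ∀ t > t₀, f' t ≤ -(κ * (f t ^ 2 - k ^ 2)))
    (hsq : ∀ t > t₀, k ^ 2 ≤ f t ^ 2) :
    Tendsto f atTop (𝓝 k) ∨ ∀ᶠ t in atTop, f t = -k := by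
  have habs (t) (ht : t > t₀) : k ≤ |f t| := by
    simpa [abs_of_pos hk] using sq_le_sq.1 (hsq t ht)
  have hanti : AntitoneOn f (Set.Ioi t₀) := antitoneOn_Ioi_of_hasDerivAt_nonpos hf fun t ht => by
    linarith [hle t ht, mul_nonneg hκ.le (sub_nonneg.2 (hsq t ht))]
  by_cases hpos : ∀ t > t₀, 0 < f t
  · exact .inl (tendsto_of_deriv_le_of_le hκ hk hf hle fun t ht => by
      simpa only [abs_of_pos (hpos t ht)] using habs t ht)
  right
  push Not at hpos
  obtain ⟨t₁, ht₁, hneg⟩ := hpos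
  have hle_neg (t) (ht : t > t₁) : f t ≤ -k := by
    have ht₀ : t > t₀ := ht₁.trans ht
    have hft : f t ≤ 0 := (hanti ht₁ ht₀ ht.le).trans hneg
    have := habs t ht₀
    rw [abs_of_nonpos hft] at this
    linarith
  filter_upwards [eventually_gt_atTop t₁] with t₂ ht₂
  have ht₀ : t₂ > t₀ := ht₁.trans ht₂
  refine (hle_neg t₂ ht₂).eq_of_not_lt fun hlt => ?_
  exact not_lt_neg_of_deriv_le hκ hk (fun t ht => hf t (ht₀.trans ht))
    (fun t ht => hle t (ht₀.trans ht))
    fun t ht => (hanti ht₀ (ht₀.trans ht) (le_of_lt ht)).trans_lt hlt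

lemma tendsto_zero_of_sq_le {α : Type*} {l : Filter α} {f g : α → ℝ}
    (h : ∀ᶠ t in l, f t ^ 2 ≤ g t) (hg : Tendsto g l (𝓝 0)) : Tendsto f l (𝓝 0) := by
  have hsq : Tendsto (fun t => f t ^ 2) l (𝓝 0) :=
    squeeze_zero' (Eventually.of_forall fun t => sq_nonneg _) h hg
  exact (tendsto_zero_iff_abs_tendsto_zero _).2
    (by simpa [Real.sqrt_sq_eq_abs, Function.comp_def] using hsq.sqrt)

end DifferentialInequalities

end Preliminaries

section StructureConstants

variable {ι : Type*}

/-- The Levi-Civita connection `∇_{e_b} e_d = Γ^a_{bd} e_a` of a left-invariant metric with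
structure constants `c` in an orthonormal frame, `[e_b, e_d] = c^a_{bd} e_a`, where
`Γ^a_{bd} = spatialConn c a b d`. -/
noncomputable def spatialConn (c : ι → ι → ι → ℝ) (a b d : ι) : ℝ :=
  (c a b d - (c d b a + c b d a)) / 2

/-- The Riemann tensor `R^a_{bij}` of a left-invariant metric with structure constants `c` in an
orthonormal frame. -/
noncomputable def spatialRiemann [Fintype ι] (c : ι → ι → ι → ℝ) (a b i j : ι) : ℝ :=
  ∑ l, (spatialConn c a i l * spatialConn c l j b - spatialConn c a j l * spatialConn c l i b
    - c l i j * spatialConn c a l b)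

/-- The scalar curvature of a left-invariant metric with structure constants `c` in an orthonormal
frame. -/
noncomputable def spatialScalar [Fintype ι] (c : ι → ι → ι → ℝ) : ℝ :=
  ∑ a, ∑ b, spatialRiemann c a b a b

lemma spatialConn_sub_swap {c : ι → ι → ι → ℝ} (hc : ∀ a b f, c a b f = -c a f b)
    (a b f : ι) : spatialConn c a b f - spatialConn c a f b = c a b f := by
  simp only [spatialConn]
  linarith [hc a f b, hc f b a, hc b f a]

lemma spatialRiemann_antisymm_right [Fintype ι] {c : ι → ι → ι → ℝ}
    (hc : ∀ a b f, c a b f = -c a f b) (a b i j : ι) :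
    spatialRiemann c a b i j = -spatialRiemann c a b j i := by
  simp only [spatialRiemann, ← Finset.sum_neg_distrib]
  refine Finset.sum_congr rfl fun l _ => ?_
  rw [hc l i j]
  ring

/-- The symmetric matrix `n` in the decomposition
`c^k_{ij} = ε_{ijl} n^{lk} + δ^k_j a_i - δ^k_i a_j` of three-dimensional structure constants. -/
noncomputable def behrMatrix (c : Fin 3 → Fin 3 → Fin 3 → ℝ) : Matrix (Fin 3) (Fin 3) ℝ :=
  Matrix.of fun k l => (c k (l + 1) (l + 2) + c l (k + 1) (k + 2)) / 2

/-- The vector `a` in the decomposition `c^k_{ij} = ε_{ijl} n^{lk} + δ^k_j a_i - δ^k_i a_j` of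
three-dimensional structure constants. -/
noncomputable def behrVector (c : Fin 3 → Fin 3 → Fin 3 → ℝ) (i : Fin 3) : ℝ :=
  (∑ k, c k i k) / 2

variable {c : Fin 3 → Fin 3 → Fin 3 → ℝ}

lemma spatialScalar_eq_behr (hc : ∀ k i j, c k i j = -c k j i) :
    spatialScalar c = (behrMatrix c).trace ^ 2 / 2 - ∑ i, ∑ j, behrMatrix c i j ^ 2
      - 6 * (behrVector c ⬝ᵥ behrVector c) := by
  have hdiag (k i) : c k i i = 0 := by linarith [hc k i i]
  simp only [spatialScalar, spatialRiemann, spatialConn, behrMatrix, behrVector, Matrix.trace,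
    Matrix.diag, Matrix.of_apply, dotProduct, Fin.sum_univ_three, hdiag, hc _ 1 0, hc _ 2 1,
    hc _ 0 2, Fin.reduceAdd, zero_add]
  ring

lemma behrMatrix_mulVec_behrVector (hc : ∀ k i j, c k i j = -c k j i)
    (hjac : ∀ i j k f, ∑ d, (c d j k * c f i d + c d k i * c f j d + c d i j * c f k d) = 0) :
    (behrMatrix c).mulVec (behrVector c) = 0 := by
  have hdiag (k i) : c k i i = 0 := by linarith [hc k i i]
  ext f
  have h := hjac 0 1 2 f
  revert h
  fin_cases f <;>
  · simp only [behrMatrix, behrVector, Matrix.mulVec, dotProduct, Matrix.of_apply,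
      Fin.sum_univ_three, hdiag, hc _ 1 0, hc _ 2 1, hc _ 0 2, Fin.reduceAdd, zero_add,
      Fin.zero_eta, Fin.mk_one, Fin.reduceFinMk, Pi.zero_apply]
    intro h
    linear_combination -h / 2

lemma behrMatrix_apply_of_behrVector_eq_zero (hc : ∀ k i j, c k i j = -c k j i)
    (ha : behrVector c = 0) (k l : Fin 3) : behrMatrix c k l = c l (k + 1) (k + 2) := by
  have hdiag (k i) : c k i i = 0 := by linarith [hc k i i]
  have ha (i) : ∑ k, c k i k = 0 := by simpa [behrVector] using congrFun ha i
  have h0 := ha 0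
  have h1 := ha 1
  have h2 := ha 2
  simp only [Fin.sum_univ_three, hdiag, hc _ 1 0, hc _ 2 1, hc _ 0 2] at h0 h1 h2
  fin_cases k <;> fin_cases l <;>
    simp only [behrMatrix, Matrix.of_apply, Fin.reduceAdd, zero_add, Fin.zero_eta, Fin.mk_one,
      Fin.reduceFinMk] <;> linarith

/- By the Jacobi identity `n a = 0`; if `a = 0`, then the functional `φ` spans a kernel of `n`. A
symmetric matrix `n` of size three with a kernel satisfies `(tr n)² ≤ 2 tr n²`. -/
lemma spatialScalar_nonpos (hc : ∀ k i j, c k i j = -c k j i)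
    (hjac : ∀ i j k f, ∑ d, (c d j k * c f i d + c d k i * c f j d + c d i j * c f k d) = 0)
    {φ : Fin 3 → ℝ} (hφ : φ ≠ 0) (hperfect : ∀ i j, ∑ k, φ k * c k i j = 0) :
    spatialScalar c ≤ 0 := by
  obtain ⟨v, hv, hker⟩ : ∃ v ≠ 0, (behrMatrix c).mulVec v = 0 := by
    by_cases ha : behrVector c = 0
    · refine ⟨φ, hφ, funext fun k => ?_⟩
      simp only [Matrix.mulVec, dotProduct, behrMatrix_apply_of_behrVector_eq_zero hc ha,
        Pi.zero_apply, ← hperfect (k + 1) (k + 2), mul_comm]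
    · exact ⟨behrVector c, ha, behrMatrix_mulVec_behrVector hc hjac⟩
  have htrace := sq_trace_le_of_mulVec_eq_zero hv hker
  have ha : 0 ≤ behrVector c ⬝ᵥ behrVector c := by
    simpa using dotProduct_star_self_nonneg (behrVector c)
  rw [spatialScalar_eq_behr hc]
  norm_num at htrace
  linarith

/- `R` amounts to a `3 × 3` matrix `M` acting on bivectors, and its trace to `(tr M) 1 - Mᵀ`. -/
lemma eq_zero_of_antisymm_of_ricci_eq_zero {R : Fin 3 → Fin 3 → Fin 3 → Fin 3 → ℝ}
    (hleft : ∀ a b i j, R a b i j = -R b a i j) (hright : ∀ a b i j, R a b i j = -R a b j i)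
    (hricci : ∀ b j, ∑ a, R a b a j = 0) (a b i j : Fin 3) : R a b i j = 0 := by
  have hself_left (a i j) : R a a i j = 0 := by linarith [hleft a a i j]
  have hself_right (a b i) : R a b i i = 0 := by linarith [hright a b i i]
  have hdual (k l : Fin 3) : R (k + 1) (k + 2) (l + 1) (l + 2) = 0 := by
    have h (b j) := hricci b j
    simp only [Fin.sum_univ_three] at h
    fin_cases k <;> fin_cases l <;>
      simp only [Fin.reduceAdd, zero_add, Fin.zero_eta, Fin.mk_one, Fin.reduceFinMk] <;>
      grind
  have hpair (a b : Fin 3) : a = b ∨ ∃ k : Fin 3,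
      (a = k + 1 ∧ b = k + 2) ∨ (b = k + 1 ∧ a = k + 2) := by
    decide +revert
  rcases hpair a b with rfl | ⟨k, ⟨rfl, rfl⟩ | ⟨rfl, rfl⟩⟩
  · exact hself_left ..
  all_goals rcases hpair i j with rfl | ⟨l, ⟨rfl, rfl⟩ | ⟨rfl, rfl⟩⟩
  · exact hself_right ..
  · exact hdual ..
  · rw [hright, hdual, neg_zero]
  · exact hself_right ..
  · rw [hleft, hdual, neg_zero]
  · rw [hleft, hright, hdual, neg_zero, neg_zero]

end StructureConstants

variable {𝔤 : Type*} [LieRing 𝔤] [LieAlgebra ℝ 𝔤]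

section SpaceCoeff

lemma exists_dual_ne_zero_apply_lie_eq_zero [Nontrivial 𝔤] [LieAlgebra.IsSolvable 𝔤] :
    ∃ φ : Module.Dual ℝ 𝔤, φ ≠ 0 ∧ ∀ x y : 𝔤, φ ⁅x, y⁆ = 0 := by
  have hlt := LieAlgebra.derivedSeries_lt_top_of_solvable ℝ 𝔤
  obtain ⟨φ, hφ, hle⟩ := Submodule.exists_le_ker_of_lt_top
    (LieAlgebra.derivedSeries ℝ 𝔤 1).toSubmodule (lt_top_iff_ne_top.2 fun h =>
      hlt.ne (LieSubmodule.toSubmodule_injective h))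
  refine ⟨φ, hφ, fun x y => hle ?_⟩
  rw [LieSubmodule.mem_toSubmodule, LieAlgebra.derivedSeries_def,
    LieAlgebra.derivedSeriesOfIdeal_succ, LieAlgebra.derivedSeriesOfIdeal_zero]
  exact LieSubmodule.lie_mem_lie (LieSubmodule.mem_top x) (LieSubmodule.mem_top y)

variable (e : ℝ → Module.Basis (Fin 3) ℝ 𝔤) (t : ℝ)

lemma spaceCoeff_antisymm (a b c : Fin 3) : spaceCoeff e t a b c = -spaceCoeff e t a c b := by
  rw [spaceCoeff, ← lie_skew, map_neg, spaceCoeff]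

lemma spaceCoeff_jacobi (i j k f : Fin 3) :
    ∑ d, (spaceCoeff e t d j k * spaceCoeff e t f i d + spaceCoeff e t d k i * spaceCoeff e t f j d
      + spaceCoeff e t d i j * spaceCoeff e t f k d) = 0 := by
  have hlie (a b g) : (e t).coord f ⁅e t g, ⁅e t a, e t b⁆⁆ =
      ∑ d, spaceCoeff e t d a b * spaceCoeff e t f g d := by
    conv_lhs => rw [← (e t).sum_repr ⁅e t a, e t b⁆]
    simp only [spaceCoeff, lie_sum, lie_smul, map_sum, map_smul, smul_eq_mul,
      Module.Basis.coord_apply]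
  have h := congrArg ((e t).coord f) (lie_jacobi (e t i) (e t j) (e t k))
  simpa only [map_add, hlie, map_zero, ← Finset.sum_add_distrib] using h

lemma spatialScalar_spaceCoeff_nonpos [LieAlgebra.IsSolvable 𝔤] :
    spatialScalar (spaceCoeff e t) ≤ 0 := by
  have : Nontrivial 𝔤 := (e t).repr.toEquiv.nontrivial
  obtain ⟨φ, hφ, hlie⟩ := exists_dual_ne_zero_apply_lie_eq_zero (𝔤 := 𝔤)
  refine spatialScalar_nonpos (spaceCoeff_antisymm e t) (spaceCoeff_jacobi e t)
    (φ := fun k => φ (e t k)) (fun h => hφ ((e t).ext (congrFun h))) fun i j => ?_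
  conv_rhs => rw [← hlie (e t i) (e t j), ← (e t).sum_repr ⁅e t i, e t j⁆]
  simp only [map_sum, map_smul, smul_eq_mul, spaceCoeff, Module.Basis.coord_apply, mul_comm]

end SpaceCoeff

section FrameIndices

@[simp] lemma etaDiag_zero : etaDiag 0 = -1 := rfl

@[simp] lemma etaDiag_succ (a : Fin 3) : etaDiag a.succ = 1 := by
  fin_cases a <;> rfl

lemma etaDiag_mul_self (μ : Fin 4) : etaDiag μ * etaDiag μ = 1 := by
  cases μ using Fin.cases <;> simp

@[simp] lemma eta_zero_zero : eta 0 0 = -1 := rfl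

@[simp] lemma eta_zero_succ (a : Fin 3) : eta 0 a.succ = 0 := if_neg (Fin.succ_ne_zero a).symm

@[simp] lemma eta_succ_zero (a : Fin 3) : eta a.succ 0 = 0 := if_neg (Fin.succ_ne_zero a)

@[simp] lemma eta_succ_succ (a b : Fin 3) : eta a.succ b.succ = if a = b then 1 else 0 := by
  simp [eta]

lemma frameDeriv_const_mul (μ : Fin 4) (k : ℝ) (f : ℝ → ℝ) (t : ℝ) :
    frameDeriv μ (fun s => k * f s) t = k * frameDeriv μ f t := by
  unfold frameDeriv
  split_ifs <;> simp

@[simp] lemma frameDeriv_succ (a : Fin 3) (f : ℝ → ℝ) (t : ℝ) : frameDeriv a.succ f t = 0 :=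
  if_neg (Fin.succ_ne_zero a)

@[simp] lemma frameDeriv_zero (f : ℝ → ℝ) (t : ℝ) : frameDeriv 0 f t = deriv f t := rfl

lemma pair_induction {n : ℕ} {p : Fin (n + 1) → Fin (n + 1) → Prop} (self : ∀ μ, p μ μ)
    (swap : ∀ μ ν, p μ ν → p ν μ) (succ_zero : ∀ a : Fin n, p a.succ 0)
    (succ_succ : ∀ a b : Fin n, p a.succ b.succ) (μ ν : Fin (n + 1)) : p μ ν := by
  cases μ using Fin.cases with
  | zero => cases ν using Fin.cases with
    | zero => exact self 0
    | succ b => exact swap _ _ (succ_zero b)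
  | succ a => cases ν using Fin.cases with
    | zero => exact succ_zero a
    | succ b => exact succ_succ a b

end FrameIndices

section Connection

variable (e : ℝ → Module.Basis (Fin 3) ℝ 𝔤) (t : ℝ)

/-- The expansion tensor `θ_{ab} = ∇_a u_b` of the observers `u = e₀`. -/
noncomputable def expansion (a b : Fin 3) : ℝ :=
  -(timeCoeff e t a b + timeCoeff e t b a) / 2

/-- The angular velocity of the spatial frame: the connection coefficients `Γ^a_{0b}`. -/
noncomputable def frameRotation (a b : Fin 3) : ℝ :=
  (timeCoeff e t a b - timeCoeff e t b a) / 2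

@[simp] lemma commCoeff_zero (μ ν : Fin 4) : commCoeff e t 0 μ ν = 0 := rfl

@[simp] lemma commCoeff_zero_zero (ρ : Fin 4) : commCoeff e t ρ 0 0 = 0 := by
  cases ρ using Fin.cases <;> rfl

@[simp] lemma commCoeff_succ_zero_succ (a b : Fin 3) :
    commCoeff e t a.succ 0 b.succ = timeCoeff e t a b := rfl

@[simp] lemma commCoeff_succ_succ_zero (a b : Fin 3) :
    commCoeff e t a.succ b.succ 0 = -timeCoeff e t a b := rfl

@[simp] lemma commCoeff_succ_succ_succ (a b c : Fin 3) :
    commCoeff e t a.succ b.succ c.succ = spaceCoeff e t a b c := rfl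

lemma commCoeff_antisymm (ρ μ ν : Fin 4) : commCoeff e t ρ μ ν = -commCoeff e t ρ ν μ := by
  cases ρ using Fin.cases <;> cases μ using Fin.cases <;> cases ν using Fin.cases <;>
    simp [← spaceCoeff_antisymm]

@[simp] lemma conn_zero_zero (ν : Fin 4) : conn e t 0 0 ν = 0 := by
  cases ν using Fin.cases <;> simp [conn]

@[simp] lemma conn_zero_right_zero (μ : Fin 4) : conn e t 0 μ 0 = 0 := by
  cases μ using Fin.cases <;> simp [conn]

@[simp] lemma conn_right_zero_zero (l : Fin 4) : conn e t l 0 0 = 0 := by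
  cases l using Fin.cases <;> simp [conn]

@[simp] lemma conn_zero_succ_succ (a b : Fin 3) :
    conn e t 0 a.succ b.succ = expansion e t a b := by
  simp [conn, expansion]

@[simp] lemma conn_succ_succ_zero (a b : Fin 3) :
    conn e t a.succ b.succ 0 = expansion e t a b := by
  simp only [conn, commCoeff_succ_succ_zero, commCoeff_succ_zero_succ, commCoeff_zero,
    etaDiag_succ, expansion]
  ring

@[simp] lemma conn_succ_zero_succ (a b : Fin 3) :
    conn e t a.succ 0 b.succ = frameRotation e t a b := by
  simp [conn, frameRotation]

@[simp] lemma conn_succ_succ_succ (a b c : Fin 3) :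
    conn e t a.succ b.succ c.succ = spatialConn (spaceCoeff e t) a b c := by
  simp [conn, spatialConn]

lemma conn_antisymm (l μ ν : Fin 4) :
    etaDiag l * conn e t l μ ν = -(etaDiag ν * conn e t ν μ l) := by
  have hcomm := commCoeff_antisymm e t μ ν l
  have hl := etaDiag_mul_self l
  have hν := etaDiag_mul_self ν
  simp only [conn]
  linear_combination
    (-(etaDiag ν * commCoeff e t ν μ l + etaDiag μ * commCoeff e t μ ν l) / 2) * hl
    + (-(etaDiag l * commCoeff e t l μ ν + etaDiag μ * commCoeff e t μ l ν) / 2) * hν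
    - etaDiag μ / 2 * hcomm

lemma expansion_symm (a b : Fin 3) : expansion e t a b = expansion e t b a := by
  rw [expansion, expansion, add_comm]

lemma frameRotation_antisymm (a b : Fin 3) :
    frameRotation e t a b = -frameRotation e t b a := by
  simp only [frameRotation]
  ring

lemma timeCoeff_eq (a b : Fin 3) :
    timeCoeff e t a b = frameRotation e t a b - expansion e t a b := by
  simp only [frameRotation, expansion]
  ring

lemma hubble_eq : hubble e t = (∑ a, expansion e t a a) / 3 := by
  simp [hubble, Fin.sum_univ_succ (n := 3)]

lemma expansion_eq (a b : Fin 3) :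
    expansion e t a b = shear e t a b + if a = b then hubble e t else 0 := by
  simp [shear, expansion_symm e t b a]

lemma sum_shear_diag : ∑ a, shear e t a a = 0 := by
  simp only [shear, conn_succ_succ_zero, if_true, Finset.sum_sub_distrib, Finset.sum_const,
    Finset.card_univ, Fintype.card_fin, hubble_eq]
  ring

lemma sum_sq_expansion :
    ∑ a, ∑ b, expansion e t a b ^ 2 = 3 * hubble e t ^ 2 + ∑ a, ∑ b, shear e t a b ^ 2 := by
  have htrace : ∑ a, 2 * shear e t a a * hubble e t = 0 := by
    rw [← Finset.sum_mul, ← Finset.mul_sum, sum_shear_diag, mul_zero, zero_mul]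
  simp only [expansion_eq, add_sq, mul_ite, mul_zero, ite_pow, ne_eq, OfNat.ofNat_ne_zero,
    not_false_eq_true, zero_pow, Finset.sum_add_distrib, Finset.sum_ite_eq, Finset.mem_univ,
    if_true, htrace, Finset.sum_const, Finset.card_univ, Fintype.card_fin]
  ring

end Connection

section Curvature

variable (e : ℝ → Module.Basis (Fin 3) ℝ 𝔤) (t : ℝ)

lemma riemann_antisymm_right (ρ σ μ ν : Fin 4) :
    riemann e t ρ σ μ ν = -riemann e t ρ σ ν μ := by
  simp only [riemann, neg_add, ← Finset.sum_neg_distrib, neg_sub]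
  congr 1
  refine Finset.sum_congr rfl fun l _ => ?_
  rw [commCoeff_antisymm e t l μ ν]
  ring

lemma riemann_antisymm_left (ρ σ μ ν : Fin 4) :
    etaDiag ρ * riemann e t ρ σ μ ν = -(etaDiag σ * riemann e t σ ρ μ ν) := by
  have hderiv (α β) : etaDiag ρ * frameDeriv α (fun s => conn e s ρ β σ) t =
      -(etaDiag σ * frameDeriv α (fun s => conn e s σ β ρ) t) := by
    rw [← frameDeriv_const_mul, ← neg_mul, ← frameDeriv_const_mul]
    exact congrArg (frameDeriv α · t) (funext fun s => by rw [conn_antisymm, neg_mul])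
  have hmul (α β l) : etaDiag ρ * (conn e t ρ α l * conn e t l β σ) =
      etaDiag σ * (conn e t σ β l * conn e t l α ρ) := by
    linear_combination conn e t l β σ * conn_antisymm e t ρ α l
      - conn e t l α ρ * conn_antisymm e t l β σ
  have hcomm (l) : etaDiag ρ * (commCoeff e t l μ ν * conn e t ρ l σ) =
      -(etaDiag σ * (commCoeff e t l μ ν * conn e t σ l ρ)) := by
    linear_combination commCoeff e t l μ ν * conn_antisymm e t ρ l σ
  simp only [riemann, mul_add, mul_sub, neg_add, Finset.mul_sum, ← Finset.sum_neg_distrib,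
    hderiv, hmul, hcomm]
  congr 1
  · ring
  · exact Finset.sum_congr rfl fun l _ => by ring

lemma riemann_self_left (ρ μ ν : Fin 4) : riemann e t ρ ρ μ ν = 0 := by
  have h : etaDiag ρ * riemann e t ρ ρ μ ν = 0 := self_eq_neg.1 (riemann_antisymm_left e t ρ ρ μ ν)
  linear_combination etaDiag ρ * h - riemann e t ρ ρ μ ν * etaDiag_mul_self ρ

lemma riemann_self_right (ρ σ μ : Fin 4) : riemann e t ρ σ μ μ = 0 :=
  self_eq_neg.1 (riemann_antisymm_right e t ρ σ μ μ)

lemma riemann_spatial (a b i j : Fin 3) :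
    riemann e t a.succ b.succ i.succ j.succ = spatialRiemann (spaceCoeff e t) a b i j
      + (expansion e t a i * expansion e t j b - expansion e t a j * expansion e t i b) := by
  simp only [riemann, Fin.sum_univ_succ (n := 3), frameDeriv_succ, conn_succ_succ_zero,
    conn_zero_succ_succ, conn_succ_succ_succ, commCoeff_zero, commCoeff_succ_succ_succ,
    spatialRiemann]
  ring

lemma riemann_codazzi (a i j : Fin 3) :
    riemann e t a.succ 0 i.succ j.succ =
      ∑ l, (spatialConn (spaceCoeff e t) a i l * expansion e t l j
        - spatialConn (spaceCoeff e t) a j l * expansion e t l i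
        - spaceCoeff e t l i j * expansion e t a l) := by
  simp [riemann, Fin.sum_univ_succ (n := 3)]

lemma riemann_mixed (a b j : Fin 3) :
    riemann e t a.succ b.succ 0 j.succ =
      deriv (fun s => spatialConn (spaceCoeff e s) a j b) t
      + ∑ l, (frameRotation e t a l * spatialConn (spaceCoeff e t) l j b
        - spatialConn (spaceCoeff e t) a j l * frameRotation e t l b
        - timeCoeff e t l j * spatialConn (spaceCoeff e t) a l b) := by
  simp [riemann, Fin.sum_univ_succ (n := 3)]

lemma riemann_electric (a b : Fin 3) :
    riemann e t a.succ 0 b.succ 0 = -deriv (fun s => expansion e s a b) t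
      + ∑ l, (timeCoeff e t l b * expansion e t a l
        - frameRotation e t a l * expansion e t l b) := by
  simp only [riemann, Fin.sum_univ_succ (n := 3), frameDeriv_succ, frameDeriv_zero,
    conn_right_zero_zero, conn_succ_succ_zero, conn_zero_right_zero, conn_succ_zero_succ,
    commCoeff_zero, commCoeff_succ_succ_zero, mul_zero, sub_zero, zero_sub, neg_zero,
    zero_add, neg_mul, sub_neg_eq_add]
  exact congrArg _ (Finset.sum_congr rfl fun l _ => by ring)

lemma ricci_spatial (a b : Fin 3) :
    ricci e t a.succ b.succ = -riemann e t a.succ 0 b.succ 0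
      + ∑ c : Fin 3, riemann e t c.succ a.succ c.succ b.succ := by
  have h := riemann_antisymm_left e t 0 a.succ 0 b.succ
  simp only [etaDiag_zero, etaDiag_succ, one_mul, neg_mul, neg_inj] at h
  rw [ricci, Fin.sum_univ_succ, h, riemann_antisymm_right e t a.succ 0 0 b.succ]

lemma ricci_zero_zero : ricci e t 0 0 = ∑ a : Fin 3, riemann e t a.succ 0 a.succ 0 := by
  rw [ricci, Fin.sum_univ_succ, riemann_self_left, zero_add]

lemma einstein_zero_zero :
    einstein e t 0 0 = spatialScalar (spaceCoeff e t) / 2 + 3 * hubble e t ^ 2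
      - (∑ a, ∑ b, shear e t a b ^ 2) / 2 := by
  have hspatial : ∑ a : Fin 3, ∑ b : Fin 3, riemann e t b.succ a.succ b.succ a.succ =
      spatialScalar (spaceCoeff e t) + ((∑ a, expansion e t a a) ^ 2
        - ∑ a, ∑ b, expansion e t a b ^ 2) := by
    rw [Finset.sum_comm, sq, Finset.sum_mul_sum]
    simp only [riemann_spatial, spatialScalar, Finset.sum_add_distrib, Finset.sum_sub_distrib, sq]
  have htrace : ∑ a, expansion e t a a = 3 * hubble e t := by
    rw [hubble_eq]
    ring
  simp only [einstein, scalarCurv, Fin.sum_univ_succ (n := 3), etaDiag_zero, etaDiag_succ,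
    eta_zero_zero, one_mul, ricci_spatial, Finset.sum_add_distrib, Finset.sum_neg_distrib,
    hspatial, ← ricci_zero_zero, htrace, sum_sq_expansion]
  ring

lemma ricci_eq_einstein_sub (μ ν : Fin 4) :
    ricci e t μ ν = einstein e t μ ν
      - (∑ α, etaDiag α * einstein e t α α) / 2 * eta μ ν := by
  have htrace : ∑ α, etaDiag α * einstein e t α α = -scalarCurv e t := by
    have h (α) : etaDiag α * einstein e t α α =
        etaDiag α * ricci e t α α - scalarCurv e t / 2 := by
      rw [einstein, eta, if_pos rfl]
      linear_combination -(scalarCurv e t / 2) * etaDiag_mul_self α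
    rw [Finset.sum_congr rfl fun α _ => h α, Finset.sum_sub_distrib, ← scalarCurv,
      Finset.sum_const, Finset.card_univ, Fintype.card_fin]
    ring
  rw [htrace, einstein]
  ring

end Curvature

section ChangeOfBasis

variable {ι : Type*} [Fintype ι]

lemma sum_mul_eq_zero_of_antisymm_of_symm {A S : ι → ι → ℝ} (hA : ∀ a b, A a b = -A b a)
    (hS : ∀ a b, S a b = S b a) : ∑ a, ∑ b, A a b * S a b = 0 := by
  refine self_eq_neg.1 ?_
  calc ∑ a, ∑ b, A a b * S a b = ∑ a, ∑ b, A b a * S b a := Finset.sum_comm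
    _ = ∑ a, ∑ b, -(A a b * S a b) := Finset.sum_congr rfl fun a _ =>
        Finset.sum_congr rfl fun b _ => by rw [hA b a, hS b a, neg_mul]
    _ = -∑ a, ∑ b, A a b * S a b := by simp only [Finset.sum_neg_distrib]

/-- The contraction `c_{abf} c_{dbf}` of structure constants over the lower indices, which governs
the evolution of `c_{abf} c_{abf}` under a change of basis. -/
def upperGram (c : ι → ι → ι → ℝ) (a d : ι) : ℝ := ∑ b, ∑ f, c a b f * c d b f

/-- The contraction `c_{abf} c_{adf}` of structure constants over the upper and one lower index,
which governs the evolution of `c_{abf} c_{abf}` under a change of basis. -/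
def lowerGram (c : ι → ι → ι → ℝ) (b d : ι) : ℝ := ∑ a, ∑ f, c a b f * c a d f

variable (c : ι → ι → ι → ℝ)

lemma upperGram_symm (a d : ι) : upperGram c a d = upperGram c d a := by
  simp only [upperGram, mul_comm]

lemma lowerGram_symm (b d : ι) : lowerGram c b d = lowerGram c d b := by
  simp only [lowerGram, mul_comm]

lemma sum_upperGram_diag : ∑ a, upperGram c a a = ∑ a, ∑ b, ∑ f, c a b f ^ 2 := by
  simp only [upperGram, sq]

lemma sum_lowerGram_diag : ∑ b, lowerGram c b b = ∑ a, ∑ b, ∑ f, c a b f ^ 2 := by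
  simp only [lowerGram, sq]
  exact Finset.sum_comm

lemma abs_upperGram_le (a d : ι) : |upperGram c a d| ≤ ∑ a, ∑ b, ∑ f, c a b f ^ 2 := by
  have hle (a) : ∑ b, ∑ f, c a b f ^ 2 ≤ ∑ a, ∑ b, ∑ f, c a b f ^ 2 :=
    Finset.single_le_sum (f := fun a => ∑ b, ∑ f, c a b f ^ 2) (fun a _ => by positivity)
      (Finset.mem_univ a)
  calc |upperGram c a d| ≤ ∑ b, ∑ f, |c a b f * c d b f| :=
        (Finset.abs_sum_le_sum_abs _ _).trans
          (Finset.sum_le_sum fun b _ => Finset.abs_sum_le_sum_abs _ _)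
    _ ≤ ∑ b, ∑ f, (c a b f ^ 2 + c d b f ^ 2) / 2 :=
        Finset.sum_le_sum fun b _ => Finset.sum_le_sum fun f _ => abs_mul_le_half_add_sq _ _
    _ = ((∑ b, ∑ f, c a b f ^ 2) + ∑ b, ∑ f, c d b f ^ 2) / 2 := by
        simp only [← Finset.sum_div, Finset.sum_add_distrib]
    _ ≤ _ := by linarith [hle a, hle d]

lemma lowerGram_eq_upperGram (b d : ι) :
    lowerGram c b d = upperGram (fun b a f => c a b f) b d := rfl

lemma abs_lowerGram_le (b d : ι) : |lowerGram c b d| ≤ ∑ a, ∑ b, ∑ f, c a b f ^ 2 := by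
  rw [lowerGram_eq_upperGram, Finset.sum_comm]
  exact abs_upperGram_le _ b d

lemma sum_mul_sum_eq_gram {c} (hc : ∀ a b f, c a b f = -c a f b) (A : ι → ι → ℝ) :
    ∑ a, ∑ b, ∑ f, c a b f *
        ∑ d, (-(A a d * c d b f) + A d b * c a d f + A d f * c a b d) =
      ∑ a, ∑ d, A a d * (2 * lowerGram c a d - upperGram c a d) := by
  have hupper : ∑ a, ∑ b, ∑ f, ∑ d, c a b f * (A a d * c d b f) =
      ∑ a, ∑ d, A a d * upperGram c a d := by
    simp only [upperGram, Finset.mul_sum, mul_left_comm]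
    exact Finset.sum_congr rfl fun a _ => Finset.sum_comm_cycle
  have hlower : ∑ a, ∑ b, ∑ f, ∑ d, c a b f * (A d b * c a d f) =
      ∑ d, ∑ b, A d b * lowerGram c d b := by
    calc _ = ∑ a, ∑ d, ∑ b, ∑ f, A d b * (c a d f * c a b f) :=
          Finset.sum_congr rfl fun a _ => Finset.sum_comm_cycle.trans <|
            Finset.sum_congr rfl fun d _ => Finset.sum_congr rfl fun b _ =>
              Finset.sum_congr rfl fun f _ => by ring
      _ = _ := by
          simp only [lowerGram, Finset.mul_sum]
          exact Finset.sum_comm.trans (Finset.sum_congr rfl fun d _ => Finset.sum_comm)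
  have hlower' : ∑ a, ∑ b, ∑ f, ∑ d, c a b f * (A d f * c a b d) =
      ∑ d, ∑ b, A d b * lowerGram c d b := by
    rw [← hlower]
    refine Finset.sum_congr rfl fun a _ => Finset.sum_comm.trans ?_
    refine Finset.sum_congr rfl fun b _ => Finset.sum_congr rfl fun f _ =>
      Finset.sum_congr rfl fun d _ => ?_
    rw [hc a b f, hc a d f]
    ring
  simp only [mul_add, Finset.mul_sum, Finset.sum_add_distrib, mul_neg, Finset.sum_neg_distrib,
    hupper, hlower, hlower', mul_sub, Finset.sum_sub_distrib, two_mul]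
  ring

end ChangeOfBasis

section Derivatives

/-- The frame vectors depend on time in a `C²` way near `t`. -/
def FrameContDiffAt (e : ℝ → Module.Basis (Fin 3) ℝ 𝔤) (t : ℝ) : Prop :=
  ∀ (φ : Module.Dual ℝ 𝔤) (a : Fin 3), ContDiffAt ℝ 2 (fun s => φ (e s a)) t

variable {e : ℝ → Module.Basis (Fin 3) ℝ 𝔤} {t : ℝ}

lemma coord_eq_sum {ι : Type*} [Fintype ι] (B C : Module.Basis ι ℝ 𝔤) (a : ι) (v : 𝔤) :
    C.coord a v = ∑ d, C.coord a (B d) * B.coord d v := by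
  conv_lhs => rw [← B.sum_repr v]
  simp only [map_sum, map_smul, smul_eq_mul, Module.Basis.coord_apply, mul_comm]

lemma coord_apply_self {ι : Type*} [DecidableEq ι] (B : Module.Basis ι ℝ 𝔤) (a b : ι) :
    B.coord a (B b) = if a = b then 1 else 0 := by
  rw [Module.Basis.coord_apply, B.repr_self_apply]
  simp only [eq_comm]

lemma FrameContDiffAt.contDiffAt_coord (he : FrameContDiffAt e t) (a : Fin 3) (v : 𝔤) :
    ContDiffAt ℝ 2 (fun s => (e s).coord a v) t := by
  set B := e t
  have hinv (s) : (B.toMatrix (e s))⁻¹ = (e s).toMatrix B :=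
    Matrix.inv_eq_right_inv (Module.Basis.toMatrix_mul_toMatrix_flip B (e s))
  have hdet : (B.toMatrix (e t)).det ≠ 0 := by
    rw [B.toMatrix_self, Matrix.det_one]
    exact one_ne_zero
  have hcoord (d) : ContDiffAt ℝ 2 (fun s => (e s).coord a (B d)) t := by
    have h := contDiffAt_matrix_inv (A := fun s => B.toMatrix (e s))
      (fun i j => he (B.coord i) j) hdet a d
    simp only [hinv] at h
    exact h
  simp only [coord_eq_sum B (e _) a v]
  exact ContDiffAt.sum fun d _ => (hcoord d).mul contDiffAt_const

lemma FrameContDiffAt.hasDerivAt_coord_apply (he : FrameContDiffAt e t) (a b : Fin 3) :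
    HasDerivAt (fun s => (e t).coord a (e s b)) (timeCoeff e t a b) t :=
  ((he _ b).differentiableAt two_ne_zero).hasDerivAt

lemma FrameContDiffAt.hasDerivAt_coord (he : FrameContDiffAt e t) (a b : Fin 3) :
    HasDerivAt (fun s => (e s).coord a (e t b)) (-timeCoeff e t a b) t := by
  have hdiff (d) := ((he.contDiffAt_coord a (e t d)).differentiableAt two_ne_zero).hasDerivAt
  have hsum := HasDerivAt.fun_sum (u := Finset.univ) fun d _ =>
    (hdiff d).mul (he.hasDerivAt_coord_apply d b)
  simp only [Pi.mul_apply, ← coord_eq_sum, coord_apply_self] at hsum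
  have h := hsum.unique (hasDerivAt_const t _)
  simp only [mul_ite, ite_mul, mul_one, mul_zero, one_mul, zero_mul, Finset.sum_add_distrib,
    Finset.sum_ite_eq, Finset.sum_ite_eq', Finset.mem_univ, if_true] at h
  exact eq_neg_of_add_eq_zero_left h ▸ hdiff b

lemma timeCoeff_eq_sum (B : Module.Basis (Fin 3) ℝ 𝔤) {b : Fin 3}
    (hB : ∀ d, DifferentiableAt ℝ (fun s => B.coord d (e s b)) t) (a : Fin 3) :
    timeCoeff e t a b = ∑ d, (e t).coord a (B d) * deriv (fun s => B.coord d (e s b)) t := by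
  simp only [timeCoeff, coord_eq_sum B (e t) a (e _ b)]
  rw [deriv_fun_sum fun d _ => (hB d).const_mul _]
  simp only [deriv_const_mul_field]

lemma FrameContDiffAt.differentiableAt_timeCoeff (he : FrameContDiffAt e t) (a b : Fin 3) :
    DifferentiableAt ℝ (fun s => timeCoeff e s a b) t := by
  have hderiv (d) : DifferentiableAt ℝ (deriv (fun s => (e t).coord d (e s b))) t :=
    by
    have h := ((he ((e t).coord d) b).fderiv_right (m := 1) (by norm_num)).differentiableAt
      one_ne_zero
    simpa only [fderiv_apply_one_eq_deriv] using h.clm_apply (differentiableAt_const (1 : ℝ))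
  have hsum : DifferentiableAt ℝ (fun s => ∑ d,
      (e s).coord a (e t d) * deriv (fun s => (e t).coord d (e s b)) s) t :=
    DifferentiableAt.fun_sum fun d _ => (he.hasDerivAt_coord a d).differentiableAt.mul (hderiv d)
  refine hsum.congr_of_eventuallyEq ?_
  have hev : ∀ᶠ s in 𝓝 t, ∀ d, ContDiffAt ℝ 2 (fun s => (e t).coord d (e s b)) s :=
    eventually_all.2 fun d => (he _ b).eventually (by simp)
  filter_upwards [hev] with s hs
  exact timeCoeff_eq_sum (e t) (fun d => (hs d).differentiableAt two_ne_zero) a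

lemma FrameContDiffAt.differentiableAt_expansion (he : FrameContDiffAt e t) (a b : Fin 3) :
    DifferentiableAt ℝ (fun s => expansion e s a b) t :=
  ((he.differentiableAt_timeCoeff a b).add (he.differentiableAt_timeCoeff b a)).neg.div_const 2

lemma FrameContDiffAt.hasDerivAt_hubble (he : FrameContDiffAt e t) :
    HasDerivAt (hubble e) ((∑ a, deriv (fun s => expansion e s a a) t) / 3) t := by
  rw [show hubble e = fun s => (∑ a, expansion e s a a) / 3 from funext (hubble_eq e)]
  exact (HasDerivAt.fun_sum fun a _ => (he.differentiableAt_expansion a a).hasDerivAt).div_const 3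

lemma spaceCoeff_eq_sum (B : Module.Basis (Fin 3) ℝ 𝔤) (a b c : Fin 3) :
    spaceCoeff e t a b c = ∑ f, ∑ p, ∑ r, (e t).coord a (B f) *
      (B.coord p (e t b) * B.coord r (e t c)) * B.coord f ⁅B p, B r⁆ := by
  have hbracket (f) : B.coord f ⁅e t b, e t c⁆ = ∑ p, ∑ r,
      B.coord p (e t b) * B.coord r (e t c) * B.coord f ⁅B p, B r⁆ := by
    conv_lhs => rw [← B.sum_repr (e t b), ← B.sum_repr (e t c)]
    simp only [sum_lie, lie_sum, smul_lie, lie_smul, map_sum, map_smul, smul_eq_mul,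
      Module.Basis.coord_apply, Finset.mul_sum, mul_assoc, mul_left_comm]
    exact Finset.sum_comm
  simp only [spaceCoeff, coord_eq_sum B (e t) a ⁅_, _⁆, hbracket, Finset.mul_sum, mul_assoc]

lemma FrameContDiffAt.hasDerivAt_spaceCoeff (he : FrameContDiffAt e t) (a b c : Fin 3) :
    HasDerivAt (fun s => spaceCoeff e s a b c)
      (∑ d, (-(timeCoeff e t a d * spaceCoeff e t d b c) + timeCoeff e t d b * spaceCoeff e t a d c
        + timeCoeff e t d c * spaceCoeff e t a b d)) t := by
  have hsum := HasDerivAt.fun_sum (u := Finset.univ) fun f _ =>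
    HasDerivAt.fun_sum (u := Finset.univ) fun p _ =>
      HasDerivAt.fun_sum (u := Finset.univ) fun r _ =>
        ((he.hasDerivAt_coord a f).mul
          ((he.hasDerivAt_coord_apply p b).mul (he.hasDerivAt_coord_apply r c))).mul_const
            ((e t).coord f ⁅e t p, e t r⁆)
  simp only [Pi.mul_apply, ← spaceCoeff_eq_sum] at hsum
  refine hsum.congr_deriv ?_
  simp only [coord_apply_self]
  simp only [mul_ite, mul_one, mul_zero, ite_mul, one_mul, zero_mul, mul_add,
    Module.Basis.coord_apply, add_mul, neg_mul, Finset.sum_add_distrib, Finset.sum_ite_eq',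
    Finset.mem_univ, ↓reduceIte, Finset.sum_ite_irrel, Finset.sum_const_zero,
    Finset.sum_neg_distrib, Finset.sum_ite_eq, spaceCoeff]
  ring

lemma FrameContDiffAt.hasDerivAt_sum_sq_spaceCoeff (he : FrameContDiffAt e t) :
    HasDerivAt (fun s => ∑ a, ∑ b, ∑ f, spaceCoeff e s a b f ^ 2)
      (-2 * hubble e t * ∑ a, ∑ b, ∑ f, spaceCoeff e t a b f ^ 2
        + 2 * ∑ a, ∑ d, shear e t a d *
          (upperGram (spaceCoeff e t) a d - 2 * lowerGram (spaceCoeff e t) a d)) t := by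
  have hsum := HasDerivAt.fun_sum (u := Finset.univ) fun a _ =>
    HasDerivAt.fun_sum (u := Finset.univ) fun b _ =>
      HasDerivAt.fun_sum (u := Finset.univ) fun f _ => (he.hasDerivAt_spaceCoeff a b f).fun_pow 2
  set c := spaceCoeff e t
  set G : Fin 3 → Fin 3 → ℝ := fun a d => 2 * lowerGram c a d - upperGram c a d
  have hrotation : ∑ a, ∑ d, frameRotation e t a d * G a d = 0 :=
    sum_mul_eq_zero_of_antisymm_of_symm (frameRotation_antisymm e t) fun a d => by
      simp only [G, lowerGram_symm c a d, upperGram_symm c a d]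
  have htrace : ∑ a, G a a = ∑ a, ∑ b, ∑ f, c a b f ^ 2 := by
    simp only [G, Finset.sum_sub_distrib, ← Finset.mul_sum, sum_lowerGram_diag,
      sum_upperGram_diag]
    ring
  have htime : ∑ a, ∑ d, timeCoeff e t a d * G a d =
      -(∑ a, ∑ d, shear e t a d * G a d) - hubble e t * ∑ a, ∑ b, ∑ f, c a b f ^ 2 := by
    simp only [timeCoeff_eq, expansion_eq, sub_mul, add_mul, ite_mul, zero_mul,
      Finset.sum_sub_distrib, Finset.sum_add_distrib, Finset.sum_ite_eq, Finset.mem_univ, if_true,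
      ← Finset.mul_sum, hrotation, htrace]
    ring
  refine hsum.congr_deriv ?_
  simp only [Nat.cast_ofNat, Nat.add_one_sub_one, pow_one, mul_assoc, ← Finset.mul_sum]
  rw [sum_mul_sum_eq_gram (spaceCoeff_antisymm e t), htime]
  simp only [G, mul_sub, Finset.sum_sub_distrib]
  ring

lemma FrameContDiffAt.deriv_sum_sq_spaceCoeff_le (he : FrameContDiffAt e t) {s : ℝ}
    (hs : ∀ a b, |shear e t a b| ≤ s) :
    deriv (fun s => ∑ a, ∑ b, ∑ f, spaceCoeff e s a b f ^ 2) t ≤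
      -(2 * (hubble e t - 27 * s)) * ∑ a, ∑ b, ∑ f, spaceCoeff e t a b f ^ 2 := by
  rw [he.hasDerivAt_sum_sq_spaceCoeff.deriv]
  set c := spaceCoeff e t
  set y := ∑ a, ∑ b, ∑ f, c a b f ^ 2
  have hle (a d) : shear e t a d * (upperGram c a d - 2 * lowerGram c a d) ≤ s * (3 * y) := by
    have hgram : |upperGram c a d - 2 * lowerGram c a d| ≤ 3 * y := by
      have hupper := abs_le.1 (abs_upperGram_le c a d)
      have hlower := abs_le.1 (abs_lowerGram_le c a d)
      exact abs_le.2 ⟨by linarith, by linarith⟩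
    refine (le_abs_self _).trans ?_
    rw [abs_mul]
    exact mul_le_mul (hs a d) hgram (abs_nonneg _) ((abs_nonneg _).trans (hs a d))
  have hsum : ∑ a, ∑ d, shear e t a d * (upperGram c a d - 2 * lowerGram c a d) ≤
      ∑ _a : Fin 3, ∑ _d : Fin 3, s * (3 * y) :=
    Finset.sum_le_sum fun a _ => Finset.sum_le_sum fun d _ => hle a d
  simp only [Finset.sum_const, Finset.card_univ, Fintype.card_fin, nsmul_eq_mul] at hsum
  push_cast at hsum
  linarith

end Derivatives

section CurvatureEvolution

variable {e : ℝ → Module.Basis (Fin 3) ℝ 𝔤} {t : ℝ}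

lemma FrameContDiffAt.ricci_zero_zero (he : FrameContDiffAt e t) :
    ricci e t 0 0 = -3 * (deriv (hubble e) t + hubble e t ^ 2)
      - ∑ a, ∑ b, shear e t a b ^ 2 := by
  have hrotation := sum_mul_eq_zero_of_antisymm_of_symm (frameRotation_antisymm e t)
    (expansion_symm e t)
  have hterm (a l : Fin 3) : timeCoeff e t l a * expansion e t a l
      - frameRotation e t a l * expansion e t l a =
      -2 * (frameRotation e t a l * expansion e t a l) - expansion e t a l ^ 2 := by
    rw [timeCoeff_eq, frameRotation_antisymm e t l a, expansion_symm e t l a]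
    ring
  simp only [Bianchi.ricci_zero_zero, riemann_electric, hterm, Finset.sum_add_distrib,
    Finset.sum_sub_distrib, Finset.sum_neg_distrib, ← Finset.mul_sum, hrotation, sum_sq_expansion,
    he.hasDerivAt_hubble.deriv]
  ring

lemma FrameContDiffAt.riemann_pair_symm (he : FrameContDiffAt e t) (a b j : Fin 3) :
    riemann e t a.succ b.succ j.succ 0 = riemann e t j.succ 0 a.succ b.succ := by
  have hc := spaceCoeff_antisymm e t
  have hω := frameRotation_antisymm e t
  have hθ := expansion_symm e t
  have hderiv : HasDerivAt (fun s => spatialConn (spaceCoeff e s) a j b) _ t :=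
    ((he.hasDerivAt_spaceCoeff a j b).sub
      ((he.hasDerivAt_spaceCoeff b j a).add (he.hasDerivAt_spaceCoeff j b a))).div_const 2
  rw [riemann_antisymm_right, riemann_mixed, riemann_codazzi, hderiv.deriv,
    ← Finset.sum_add_distrib, ← Finset.sum_sub_distrib, Finset.sum_div, ← Finset.sum_add_distrib,
    ← Finset.sum_neg_distrib]
  refine Finset.sum_congr rfl fun l _ => ?_
  simp only [spatialConn, timeCoeff_eq, hω l, hθ l]
  grind

lemma riemann_codazzi_shear (a i j : Fin 3) :
    riemann e t a.succ 0 i.succ j.succ =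
      ∑ l, (spatialConn (spaceCoeff e t) a i l * shear e t l j
        - spatialConn (spaceCoeff e t) a j l * shear e t l i
        - spaceCoeff e t l i j * shear e t a l) := by
  simp only [riemann_codazzi, expansion_eq, mul_add, mul_ite, mul_zero, Finset.sum_sub_distrib,
    Finset.sum_add_distrib, Finset.sum_ite_eq, Finset.sum_ite_eq', Finset.mem_univ, if_true]
  linear_combination hubble e t * spatialConn_sub_swap (spaceCoeff_antisymm e t) a i j

lemma spatialRiemann_spaceCoeff_antisymm_left (a b i j : Fin 3) :
    spatialRiemann (spaceCoeff e t) a b i j = -spatialRiemann (spaceCoeff e t) b a i j := by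
  have h := riemann_antisymm_left e t a.succ b.succ i.succ j.succ
  simp only [etaDiag_succ, one_mul, riemann_spatial] at h
  linear_combination h + expansion e t a i * expansion_symm e t b j
    - expansion e t a j * expansion_symm e t b i + expansion e t b j * expansion_symm e t i a
    - expansion e t b i * expansion_symm e t j a

lemma riemann_electric_of_eventually_isotropic {h : ℝ}
    (hθ : ∀ᶠ s in 𝓝 t, ∀ a b, expansion e s a b = if a = b then h else 0) (a b : Fin 3) :
    riemann e t a.succ 0 b.succ 0 = -(if a = b then h ^ 2 else 0) := by
  have hderiv : deriv (fun s => expansion e s a b) t = 0 := by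
    have hconst : (fun s => expansion e s a b) =ᶠ[𝓝 t] fun _ => if a = b then h else 0 :=
      hθ.mono fun s hs => hs a b
    rw [hconst.deriv_eq, deriv_const]
  have hterm : ∑ l, (timeCoeff e t l b * expansion e t a l
      - frameRotation e t a l * expansion e t l b) =
      h * (timeCoeff e t a b - frameRotation e t a b) := by
    simp only [hθ.self_of_nhds, mul_ite, mul_zero, Finset.sum_sub_distrib, Finset.sum_ite_eq,
      Finset.sum_ite_eq', Finset.mem_univ, if_true]
    ring
  rw [riemann_electric, hderiv, hterm, timeCoeff_eq, hθ.self_of_nhds]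
  split_ifs <;> ring

lemma spatialRiemann_eq_zero_of_eventually_isotropic {h : ℝ}
    (hθ : ∀ᶠ s in 𝓝 t, ∀ a b, expansion e s a b = if a = b then h else 0)
    (hricci : ∀ a b : Fin 3, ricci e t a.succ b.succ = if a = b then 3 * h ^ 2 else 0)
    (a b i j : Fin 3) : spatialRiemann (spaceCoeff e t) a b i j = 0 := by
  refine eq_zero_of_antisymm_of_ricci_eq_zero spatialRiemann_spaceCoeff_antisymm_left
    (spatialRiemann_antisymm_right (spaceCoeff_antisymm e t)) (fun b j => ?_) a b i j
  have hsum := ricci_spatial e t b j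
  simp only [hricci, riemann_electric_of_eventually_isotropic hθ, riemann_spatial,
    hθ.self_of_nhds, Finset.sum_add_distrib, Finset.sum_sub_distrib, if_true, mul_ite, ite_mul,
    mul_zero, zero_mul, Finset.sum_ite_eq', Finset.mem_univ, Finset.sum_const,
    Finset.card_univ, Fintype.card_fin, nsmul_eq_mul, eq_comm (a := j) (b := b)] at hsum
  push_cast at hsum
  split_ifs at hsum <;> linarith

end CurvatureEvolution

section StructureConstantDecay

variable {e : ℝ → Module.Basis (Fin 3) ℝ 𝔤} {t₀ k : ℝ}

lemma tendsto_spaceCoeff (hk : 0 < k) (he : ∀ t > t₀, FrameContDiffAt e t)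
    (hH : Tendsto (hubble e) atTop (𝓝 k))
    (hσ : ∀ a b, Tendsto (fun t => shear e t a b) atTop (𝓝 0)) (a b c : Fin 3) :
    Tendsto (fun t => spaceCoeff e t a b c) atTop (𝓝 0) := by
  have hσ_small : ∀ᶠ t in atTop, ∀ a b, |shear e t a b| ≤ k / 108 :=
    eventually_all.2 fun a => eventually_all.2 fun b => by
      have h := (hσ a b).abs
      rw [abs_zero] at h
      exact h.eventually_le_const (by positivity)
  obtain ⟨t₁, ht₁⟩ := eventually_atTop.1 <| (eventually_gt_atTop t₀).and <|
    (hH.eventually_const_le (half_lt_self hk)).and hσ_small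
  have hlim : Tendsto (fun t => ∑ a, ∑ b, ∑ c, spaceCoeff e t a b c ^ 2) atTop (𝓝 0) := by
    refine tendsto_zero_of_deriv_le_neg_mul (t₀ := t₁) (κ := k / 2) (by positivity)
      (fun t ht => (he t (ht₁ t ht.le).1).hasDerivAt_sum_sq_spaceCoeff.differentiableAt.hasDerivAt)
      (fun t ht => ?_) (fun t _ => by positivity)
    obtain ⟨ht₀, hHt, hσt⟩ := ht₁ t ht.le
    exact ((he t ht₀).deriv_sum_sq_spaceCoeff_le hσt).trans
      (mul_le_mul_of_nonneg_right (by linarith) (by positivity))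
  refine tendsto_zero_of_sq_le (Eventually.of_forall fun t => ?_) hlim
  calc spaceCoeff e t a b c ^ 2 ≤ ∑ c, spaceCoeff e t a b c ^ 2 :=
        Finset.single_le_sum (f := fun c => spaceCoeff e t a b c ^ 2) (fun c _ => by positivity)
          (Finset.mem_univ c)
    _ ≤ ∑ b, ∑ c, spaceCoeff e t a b c ^ 2 :=
        Finset.single_le_sum (f := fun b => ∑ c, spaceCoeff e t a b c ^ 2)
          (fun b _ => by positivity) (Finset.mem_univ b)
    _ ≤ ∑ a, ∑ b, ∑ c, spaceCoeff e t a b c ^ 2 :=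
        Finset.single_le_sum (f := fun a => ∑ b, ∑ c, spaceCoeff e t a b c ^ 2)
          (fun a _ => by positivity) (Finset.mem_univ a)

lemma tendsto_spatialRiemann {α ι : Type*} [Fintype ι] {l : Filter α} {c : α → ι → ι → ι → ℝ}
    (hc : ∀ a b d, Tendsto (fun t => c t a b d) l (𝓝 0)) (a b i j : ι) :
    Tendsto (fun t => spatialRiemann (c t) a b i j) l (𝓝 0) := by
  have hconn (a b d) : Tendsto (fun t => spatialConn (c t) a b d) l (𝓝 0) := by
    simpa only [spatialConn, add_zero, sub_zero, zero_div] using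
      ((hc a b d).sub ((hc d b a).add (hc b d a))).div_const 2
  simpa only [spatialRiemann, mul_zero, sub_zero, Finset.sum_const_zero] using
    tendsto_finsetSum Finset.univ fun l _ => (((hconn a i l).mul (hconn l j b)).sub
      ((hconn a j l).mul (hconn l i b))).sub ((hc l i j).mul (hconn a l b))

end StructureConstantDecay

section WaldModel

/-- The energy conditions on the energy-momentum tensor `T` of the matter that drive the approach
to de Sitter space: nonnegative energy density, which dominates all components, and a uniform
combination of the dominant and strong energy conditions (with `∑ μ, etaDiag μ * T μ μ` the
trace `T^μ_μ`). -/
structure EnergyConditions (κ C : ℝ) (T : Fin 4 → Fin 4 → ℝ) : Prop where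
  energy_nonneg : 0 ≤ T 0 0
  abs_le : ∀ μ ν, |T μ ν| ≤ C * T 0 0
  focusing : κ * T 0 0 ≤ 2 * T 0 0 + (∑ μ, etaDiag μ * T μ μ) / 2

lemma EnergyConditions.add {κ κ' C C' : ℝ} {T T' : Fin 4 → Fin 4 → ℝ}
    (hT : EnergyConditions κ C T) (hT' : EnergyConditions κ' C' T') :
    EnergyConditions (min κ κ') (max C C') fun μ ν => T μ ν + T' μ ν := by
  have hT₀ := hT.energy_nonneg
  have hT₀' := hT'.energy_nonneg
  refine ⟨add_nonneg hT₀ hT₀', fun μ ν => ?_, ?_⟩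
  · refine (abs_add_le _ _).trans ?_
    linear_combination hT.abs_le μ ν + hT'.abs_le μ ν + T 0 0 * le_max_left C C'
      + T' 0 0 * le_max_right C C'
  · simp only [mul_add, Finset.sum_add_distrib]
    linear_combination hT.focusing + hT'.focusing + T 0 0 * min_le_left κ κ'
      + T' 0 0 * min_le_right κ κ'

/-- A homogeneous solution of the Einstein equations with cosmological constant `Λ` and source `T`
to which Wald's argument applies: the spatial scalar curvature is nonpositive and the source
obeys the energy conditions. -/
structure IsWaldModel (Λ κ C t₀ : ℝ) (e : ℝ → Module.Basis (Fin 3) ℝ 𝔤)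
    (T : ℝ → Fin 4 → Fin 4 → ℝ) : Prop where
  frameContDiffAt : ∀ t > t₀, FrameContDiffAt e t
  spatialScalar_nonpos : ∀ t > t₀, spatialScalar (spaceCoeff e t) ≤ 0
  energyConditions : ∀ t > t₀, EnergyConditions κ C (T t)
  einstein_eq : ∀ t > t₀, ∀ μ ν, einstein e t μ ν = T t μ ν - Λ * eta μ ν

namespace IsWaldModel

variable {e : ℝ → Module.Basis (Fin 3) ℝ 𝔤} {T : ℝ → Fin 4 → Fin 4 → ℝ} {Λ κ C t₀ t h : ℝ}

lemma ricci_eq (hM : IsWaldModel Λ κ C t₀ e T) (ht : t₀ < t) (μ ν : Fin 4) :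
    ricci e t μ ν = T t μ ν + (Λ - (∑ α, etaDiag α * T t α α) / 2) * eta μ ν := by
  have htrace : ∑ α, etaDiag α * einstein e t α α = (∑ α, etaDiag α * T t α α) - 4 * Λ := by
    have hterm (α) : etaDiag α * einstein e t α α = etaDiag α * T t α α - Λ := by
      rw [hM.einstein_eq t ht, eta, if_pos rfl]
      linear_combination -Λ * etaDiag_mul_self α
    simp only [hterm, Finset.sum_sub_distrib, Finset.sum_const, Finset.card_univ,
      Fintype.card_fin, nsmul_eq_mul]
    norm_num
  rw [ricci_eq_einstein_sub, htrace, hM.einstein_eq t ht]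
  ring

lemma friedmann (hM : IsWaldModel Λ κ C t₀ e T) (ht : t₀ < t) :
    3 * hubble e t ^ 2 - Λ = T t 0 0 + (∑ a, ∑ b, shear e t a b ^ 2) / 2
      - spatialScalar (spaceCoeff e t) / 2 := by
  have hconstraint := hM.einstein_eq t ht 0 0
  rw [einstein_zero_zero, eta_zero_zero] at hconstraint
  linarith

lemma raychaudhuri (hM : IsWaldModel Λ κ C t₀ e T) (ht : t₀ < t) :
    deriv (hubble e) t = Λ / 3 - hubble e t ^ 2 - ((∑ a, ∑ b, shear e t a b ^ 2) + T t 0 0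
      + (∑ α, etaDiag α * T t α α) / 2) / 3 := by
  have hricci := hM.ricci_eq ht 0 0
  rw [(hM.frameContDiffAt t ht).ricci_zero_zero, eta_zero_zero] at hricci
  linarith

lemma deriv_hubble_le (hM : IsWaldModel Λ κ C t₀ e T) (hκ : κ ≤ 1) (ht : t₀ < t) :
    deriv (hubble e) t ≤ -(κ * (hubble e t ^ 2 - Λ / 3)) := by
  have hσ : 0 ≤ ∑ a, ∑ b, shear e t a b ^ 2 := by positivity
  have hκσ := mul_le_mul_of_nonneg_right hκ hσ
  have hκR := mul_le_mul_of_nonneg_right hκ (neg_nonneg.2 (hM.spatialScalar_nonpos t ht))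
  have hfocus := (hM.energyConditions t ht).focusing
  linear_combination hM.raychaudhuri ht + (κ - 1) / 3 * hM.friedmann ht + hfocus / 3 + hκσ / 6
    + hκR / 6 + hσ / 3

lemma le_sq_hubble (hM : IsWaldModel Λ κ C t₀ e T) (ht : t₀ < t) :
    Λ / 3 ≤ hubble e t ^ 2 := by
  have hσ : 0 ≤ ∑ a, ∑ b, shear e t a b ^ 2 := by positivity
  linarith [hM.friedmann ht, hM.spatialScalar_nonpos t ht,
    (hM.energyConditions t ht).energy_nonneg]

lemma energy_le (hM : IsWaldModel Λ κ C t₀ e T) (ht : t₀ < t) :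
    T t 0 0 ≤ 3 * hubble e t ^ 2 - Λ := by
  have hσ : 0 ≤ ∑ a, ∑ b, shear e t a b ^ 2 := by positivity
  linarith [hM.friedmann ht, hM.spatialScalar_nonpos t ht]

lemma sq_shear_le (hM : IsWaldModel Λ κ C t₀ e T) (ht : t₀ < t) (a b : Fin 3) :
    shear e t a b ^ 2 ≤ 2 * (3 * hubble e t ^ 2 - Λ) := by
  have hle : shear e t a b ^ 2 ≤ ∑ a, ∑ b, shear e t a b ^ 2 :=
    (Finset.single_le_sum (f := fun b => shear e t a b ^ 2) (fun b _ => sq_nonneg _)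
      (Finset.mem_univ b)).trans
    (Finset.single_le_sum (f := fun a => ∑ b, shear e t a b ^ 2) (fun a _ => by positivity)
      (Finset.mem_univ a))
  linarith [hM.friedmann ht, hM.spatialScalar_nonpos t ht,
    (hM.energyConditions t ht).energy_nonneg]

lemma hubble_dichotomy (hM : IsWaldModel Λ κ C t₀ e T) (hΛ : 0 < Λ) (hκ : 0 < κ) (hκ₁ : κ ≤ 1) :
    Tendsto (hubble e) atTop (𝓝 √(Λ / 3)) ∨ ∀ᶠ t in atTop, hubble e t = -√(Λ / 3) := by
  have hsq : √(Λ / 3) ^ 2 = Λ / 3 := Real.sq_sqrt (by positivity)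
  refine tendsto_or_eventually_eq_neg_of_deriv_le hκ (Real.sqrt_pos.2 (by positivity))
    (fun t ht => (hM.frameContDiffAt t ht).hasDerivAt_hubble.differentiableAt.hasDerivAt) ?_ ?_
  · rw [hsq]
    exact fun t ht => hM.deriv_hubble_le hκ₁ ht
  · rw [hsq]
    exact fun t ht => hM.le_sq_hubble ht

lemma shear_eq_zero (hM : IsWaldModel Λ κ C t₀ e T) (ht : t₀ < t)
    (hH : hubble e t ^ 2 = Λ / 3) (a b : Fin 3) : shear e t a b = 0 :=
  pow_eq_zero_iff two_ne_zero |>.1 <| le_antisymm (by linarith [hM.sq_shear_le ht a b])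
    (sq_nonneg _)

lemma source_eq_zero (hM : IsWaldModel Λ κ C t₀ e T) (ht : t₀ < t)
    (hH : hubble e t ^ 2 = Λ / 3) (μ ν : Fin 4) : T t μ ν = 0 := by
  have hT := hM.energyConditions t ht
  have henergy : T t 0 0 = 0 := le_antisymm (by linarith [hM.energy_le ht]) hT.energy_nonneg
  have hle := hT.abs_le μ ν
  rw [henergy, mul_zero] at hle
  exact abs_nonpos_iff.1 hle

lemma spatialRiemann_eq_zero (hM : IsWaldModel Λ κ C t₀ e T) (ht : t₀ < t)
    (hh : h ^ 2 = Λ / 3) (hH : ∀ᶠ s in 𝓝 t, hubble e s = h) (a b i j : Fin 3) :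
    spatialRiemann (spaceCoeff e t) a b i j = 0 := by
  have hH_sq : hubble e t ^ 2 = Λ / 3 := by rw [hH.self_of_nhds, hh]
  refine spatialRiemann_eq_zero_of_eventually_isotropic (h := h) ?_ (fun a b => ?_) a b i j
  · filter_upwards [hH, eventually_gt_nhds ht] with s hs hts a b
    rw [expansion_eq, hM.shear_eq_zero hts (by rw [hs, hh]), zero_add, hs]
  · simp only [hM.ricci_eq ht, hM.source_eq_zero ht hH_sq, hh, eta_succ_succ, mul_zero,
      Finset.sum_const_zero, zero_div, sub_zero, zero_add, mul_ite, mul_one]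
    congr 1
    ring

section Limits

variable (hM : IsWaldModel Λ κ C t₀ e T) (hh : h ^ 2 = Λ / 3)
  (hH : Tendsto (hubble e) atTop (𝓝 h))
include hh hH

lemma tendsto_three_mul_sq_hubble_sub :
    Tendsto (fun t => 3 * hubble e t ^ 2 - Λ) atTop (𝓝 0) := by
  have hlim := ((hH.pow 2).const_mul 3).sub_const Λ
  rwa [hh, mul_div_cancel₀ Λ three_ne_zero, sub_self] at hlim

include hM

lemma tendsto_shear (a b : Fin 3) : Tendsto (fun t => shear e t a b) atTop (𝓝 0) := by
  have hlim := (tendsto_three_mul_sq_hubble_sub hh hH).const_mul 2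
  rw [mul_zero] at hlim
  exact tendsto_zero_of_sq_le ((eventually_gt_atTop t₀).mono fun t ht => hM.sq_shear_le ht a b) hlim

lemma tendsto_source (μ ν : Fin 4) : Tendsto (fun t => T t μ ν) atTop (𝓝 0) := by
  have hgt := eventually_gt_atTop t₀
  have henergy : Tendsto (fun t => T t 0 0) atTop (𝓝 0) :=
    squeeze_zero' (hgt.mono fun t ht => (hM.energyConditions t ht).energy_nonneg)
      (hgt.mono fun t ht => hM.energy_le ht) (tendsto_three_mul_sq_hubble_sub hh hH)
  have hlim := henergy.const_mul C
  rw [mul_zero] at hlim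
  exact squeeze_zero_norm' (hgt.mono fun t ht => (hM.energyConditions t ht).abs_le μ ν) hlim

lemma tendsto_ricci (μ ν : Fin 4) :
    Tendsto (fun t => ricci e t μ ν) atTop (𝓝 (Λ * eta μ ν)) := by
  have hT := hM.tendsto_source hh hH
  have htrace : Tendsto (fun t => ∑ α, etaDiag α * T t α α) atTop (𝓝 0) := by
    simpa only [mul_zero, Finset.sum_const_zero] using
      tendsto_finsetSum Finset.univ fun α _ => (hT α α).const_mul (etaDiag α)
  have hlim := (hT μ ν).add (((htrace.div_const 2).const_sub Λ).mul_const (eta μ ν))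
  rw [zero_div, sub_zero, zero_add] at hlim
  exact hlim.congr' ((eventually_gt_atTop t₀).mono fun t ht => (hM.ricci_eq ht μ ν).symm)

lemma tendsto_deriv_hubble : Tendsto (deriv (hubble e)) atTop (𝓝 0) := by
  have hσ := hM.tendsto_shear hh hH
  have hσ_sq : Tendsto (fun t => ∑ a, ∑ b, shear e t a b ^ 2) atTop (𝓝 0) := by
    simpa using tendsto_finsetSum Finset.univ fun a _ =>
      tendsto_finsetSum Finset.univ fun b _ => (hσ a b).pow 2
  have hlim := (((hM.tendsto_ricci hh hH 0 0).add hσ_sq).div_const (-3)).sub (hH.pow 2)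
  rw [hh, eta_zero_zero, show (Λ * -1 + 0) / -3 - Λ / 3 = 0 by ring] at hlim
  refine hlim.congr' ((eventually_gt_atTop t₀).mono fun t ht => ?_)
  rw [(hM.frameContDiffAt t ht).ricci_zero_zero]
  ring

end Limits

end IsWaldModel

end WaldModel

section CurvatureLimits

variable {e : ℝ → Module.Basis (Fin 3) ℝ 𝔤} {h : ℝ}

lemma tendsto_expansion (hH : Tendsto (hubble e) atTop (𝓝 h))
    (hσ : ∀ a b, Tendsto (fun t => shear e t a b) atTop (𝓝 0)) (a b : Fin 3) :
    Tendsto (fun t => expansion e t a b) atTop (𝓝 (if a = b then h else 0)) := by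
  simp only [expansion_eq]
  split_ifs
  · simpa only [zero_add] using (hσ a b).add hH
  · simpa only [add_zero] using hσ a b

lemma tendsto_riemann_spatial
    (hθ : ∀ a b, Tendsto (fun t => expansion e t a b) atTop (𝓝 (if a = b then h else 0)))
    (hR : ∀ a b i j, Tendsto (fun t => spatialRiemann (spaceCoeff e t) a b i j) atTop (𝓝 0))
    (a b i j : Fin 3) :
    Tendsto (fun t => riemann e t a.succ b.succ i.succ j.succ) atTop
      (𝓝 (h ^ 2 * (eta a.succ i.succ * eta b.succ j.succ
        - eta a.succ j.succ * eta b.succ i.succ))) := by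
  simp only [riemann_spatial]
  convert (hR a b i j).add (((hθ a i).mul (hθ j b)).sub ((hθ a j).mul (hθ i b))) using 2
  simp only [eta_succ_succ, eq_comm (a := j) (b := b), eq_comm (a := i) (b := b)]
  split_ifs <;> ring

lemma tendsto_riemann_codazzi
    (hcσ : ∀ a b c i j, Tendsto (fun t => spaceCoeff e t a b c * shear e t i j) atTop (𝓝 0))
    (a i j : Fin 3) : Tendsto (fun t => riemann e t a.succ 0 i.succ j.succ) atTop (𝓝 0) := by
  have hconn (a b c i j) :
      Tendsto (fun t => spatialConn (spaceCoeff e t) a b c * shear e t i j) atTop (𝓝 0) := by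
    have hlim := ((hcσ a b c i j).sub ((hcσ c b a i j).add (hcσ b c a i j))).div_const 2
    simp only [add_zero, sub_zero, zero_div] at hlim
    refine hlim.congr fun t => ?_
    rw [spatialConn]
    ring
  simpa only [riemann_codazzi_shear, sub_zero, Finset.sum_const_zero] using
    tendsto_finsetSum Finset.univ fun l _ =>
      ((hconn a i l l j).sub (hconn a j l l i)).sub (hcσ l i j a l)

lemma tendsto_riemann_electric
    (hricci : ∀ a b : Fin 3, Tendsto (fun t => ricci e t a.succ b.succ) atTop
      (𝓝 (3 * h ^ 2 * eta a.succ b.succ)))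
    (hspatial : ∀ a b i j : Fin 3,
      Tendsto (fun t => riemann e t a.succ b.succ i.succ j.succ) atTop
        (𝓝 (h ^ 2 * (eta a.succ i.succ * eta b.succ j.succ
          - eta a.succ j.succ * eta b.succ i.succ)))) (a b : Fin 3) :
    Tendsto (fun t => riemann e t a.succ 0 b.succ 0) atTop
      (𝓝 (-(h ^ 2 * eta a.succ b.succ))) := by
  have hlim := (tendsto_finsetSum Finset.univ fun c _ => hspatial c a c b).sub (hricci a b)
  have hvalue : ∑ c : Fin 3, h ^ 2 * (eta c.succ c.succ * eta a.succ b.succ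
      - eta c.succ b.succ * eta a.succ c.succ) = 2 * h ^ 2 * eta a.succ b.succ := by
    have hcontract : ∑ c : Fin 3, eta c.succ b.succ * eta a.succ c.succ = eta a.succ b.succ := by
      simp only [eta_succ_succ, mul_ite, mul_one, mul_zero, Finset.sum_ite_eq, Finset.mem_univ,
        if_true]
    rw [← Finset.mul_sum, Finset.sum_sub_distrib, hcontract, ← Finset.sum_mul]
    simp only [eta_succ_succ, if_true, Finset.sum_const, Finset.card_univ, Fintype.card_fin]
    ring
  rw [hvalue, show 2 * h ^ 2 * eta a.succ b.succ - 3 * h ^ 2 * eta a.succ b.succ =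
    -(h ^ 2 * eta a.succ b.succ) by ring] at hlim
  refine hlim.congr fun t => ?_
  rw [ricci_spatial]
  ring

lemma tendsto_riemann {K t₀ : ℝ} (he : ∀ t > t₀, FrameContDiffAt e t)
    (hspatial : ∀ a b i j : Fin 3,
      Tendsto (fun t => riemann e t a.succ b.succ i.succ j.succ) atTop
        (𝓝 (K * (eta a.succ i.succ * eta b.succ j.succ
          - eta a.succ j.succ * eta b.succ i.succ))))
    (hcodazzi : ∀ a i j : Fin 3,
      Tendsto (fun t => riemann e t a.succ 0 i.succ j.succ) atTop (𝓝 0))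
    (helectric : ∀ a b : Fin 3, Tendsto (fun t => riemann e t a.succ 0 b.succ 0) atTop
      (𝓝 (-(K * eta a.succ b.succ)))) (ρ σ μ ν : Fin 4) :
    Tendsto (fun t => etaDiag ρ * riemann e t ρ σ μ ν) atTop
      (𝓝 (K * (eta ρ μ * eta σ ν - eta ρ ν * eta σ μ))) := by
  have hself_right (ρ σ μ) : Tendsto (fun t => etaDiag ρ * riemann e t ρ σ μ μ) atTop
      (𝓝 (K * (eta ρ μ * eta σ μ - eta ρ μ * eta σ μ))) := by
    simp only [riemann_self_right, sub_self, mul_zero]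
    exact tendsto_const_nhds
  have hswap_right (ρ σ μ ν) (hlim : Tendsto (fun t => etaDiag ρ * riemann e t ρ σ μ ν) atTop
      (𝓝 (K * (eta ρ μ * eta σ ν - eta ρ ν * eta σ μ)))) :
      Tendsto (fun t => etaDiag ρ * riemann e t ρ σ ν μ) atTop
        (𝓝 (K * (eta ρ ν * eta σ μ - eta ρ μ * eta σ ν))) := by
    simp only [fun t => riemann_antisymm_right e t ρ σ ν μ, mul_neg]
    convert hlim.neg using 2
    ring
  revert μ ν
  refine pair_induction (p := fun ρ σ => ∀ μ ν, Tendsto (fun t => etaDiag ρ * riemann e t ρ σ μ ν)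
    atTop (𝓝 (K * (eta ρ μ * eta σ ν - eta ρ ν * eta σ μ))))
    (fun ρ μ ν => ?_) (fun ρ σ hlim μ ν => ?_) (fun a => ?_) (fun a b => ?_) ρ σ
  · simp only [riemann_self_left, mul_comm (eta ρ ν), sub_self, mul_zero]
    exact tendsto_const_nhds
  · simp only [fun t => riemann_antisymm_left e t σ ρ μ ν]
    convert (hlim μ ν).neg using 2
    ring
  · refine pair_induction (hself_right _ _) (hswap_right _ _) (fun b => ?_) fun i j => ?_
    · simpa using helectric a b
    · simpa using hcodazzi a i j
  · refine pair_induction (hself_right _ _) (hswap_right _ _) (fun j => ?_) fun i j => ?_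
    · simp only [etaDiag_succ, one_mul, eta_succ_zero, mul_zero, zero_mul, sub_zero]
      refine (hcodazzi j a b).congr' ((eventually_gt_atTop t₀).mono fun t ht => ?_)
      exact ((he t ht).riemann_pair_symm a b j).symm
    · simpa only [etaDiag_succ, one_mul] using hspatial a b i j

end CurvatureLimits

section DeSitterLimit

variable {e : ℝ → Module.Basis (Fin 3) ℝ 𝔤} {T : ℝ → Fin 4 → Fin 4 → ℝ} {Λ κ C t₀ : ℝ}

namespace IsWaldModel

lemma exists_tendsto_hubble (hM : IsWaldModel Λ κ C t₀ e T) (hΛ : 0 < Λ) (hκ : 0 < κ)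
    (hκ₁ : κ ≤ 1) :
    ∃ h, h ^ 2 = Λ / 3 ∧ Tendsto (hubble e) atTop (𝓝 h) ∧
      (∀ a b i j, Tendsto (fun t => spatialRiemann (spaceCoeff e t) a b i j) atTop (𝓝 0)) ∧
      ∀ a b c i j, Tendsto (fun t => spaceCoeff e t a b c * shear e t i j) atTop (𝓝 0) := by
  have hsq : √(Λ / 3) ^ 2 = Λ / 3 := Real.sq_sqrt (by positivity)
  have hsq' : (-√(Λ / 3)) ^ 2 = Λ / 3 := by rw [neg_sq, hsq]
  rcases hM.hubble_dichotomy hΛ hκ hκ₁ with hH | hH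
  · have hσ := hM.tendsto_shear hsq hH
    have hc := tendsto_spaceCoeff (Real.sqrt_pos.2 (by positivity)) hM.frameContDiffAt hH hσ
    refine ⟨_, hsq, hH, tendsto_spatialRiemann hc, fun a b c i j => ?_⟩
    simpa only [mul_zero] using (hc a b c).mul (hσ i j)
  · have hH' : ∀ᶠ t in atTop, ∀ᶠ s in 𝓝 t, hubble e s = -√(Λ / 3) := by
      obtain ⟨t₁, ht₁⟩ := eventually_atTop.1 hH
      filter_upwards [eventually_gt_atTop t₁] with t ht
      filter_upwards [eventually_gt_nhds ht] with s hs using ht₁ s hs.le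
    refine ⟨_, hsq', tendsto_const_nhds.congr' (hH.mono fun t ht => ht.symm),
      fun a b i j => ?_, fun a b c i j => ?_⟩
    all_goals
      refine tendsto_const_nhds.congr' ?_
      filter_upwards [hH', eventually_gt_atTop t₀] with t hHt ht
    · exact (hM.spatialRiemann_eq_zero ht hsq' hHt a b i j).symm
    · rw [hM.shear_eq_zero ht (by rw [hHt.self_of_nhds, hsq']), mul_zero]

theorem asymptoticallyDeSitter (hM : IsWaldModel Λ κ C t₀ e T) (hΛ : 0 < Λ) (hκ : 0 < κ)
    (hκ₁ : κ ≤ 1) :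
    AsymptoticallyDeSitter e ∧ Tendsto (omegaLambda Λ e) atTop (𝓝 1) := by
  obtain ⟨h, hh, hH, hR, hcσ⟩ := hM.exists_tendsto_hubble hΛ hκ hκ₁
  have hh_pos : 0 < h ^ 2 := hh ▸ by positivity
  have hh_ne : h ≠ 0 := pow_ne_zero_iff two_ne_zero |>.1 hh_pos.ne'
  have hσ := hM.tendsto_shear hh hH
  have hΛh : Λ = 3 * h ^ 2 := by linarith
  have hspatial := tendsto_riemann_spatial (tendsto_expansion hH hσ) hR
  have helectric := tendsto_riemann_electric
    (fun a b => hΛh ▸ hM.tendsto_ricci hh hH a.succ b.succ) hspatial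
  refine ⟨⟨⟨h ^ 2, hh_pos, tendsto_riemann hM.frameContDiffAt hspatial
    (tendsto_riemann_codazzi hcσ) helectric⟩, fun a b => ?_, ?_⟩, ?_⟩
  · have hlim := (hσ a b).div hH hh_ne
    rwa [zero_div] at hlim
  · have hlim := ((hM.tendsto_deriv_hubble hh hH).div (hH.pow 2) hh_pos.ne').const_sub (-1)
    rwa [zero_div, sub_zero] at hlim
  · have hlim := (tendsto_const_nhds (x := Λ)).div ((hH.pow 2).const_mul 3) (by positivity)
    rwa [← hΛh, div_self hΛ.ne'] at hlim

end IsWaldModel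

end DeSitterLimit

section FormField

/-- The components `A` are totally antisymmetric in their indices, as those of a differential form
are. -/
def IsForm {n : ℕ} (A : (Fin n → Fin 4) → ℝ) : Prop :=
  ∀ (m : Fin n → Fin 4) (s : Equiv.Perm (Fin n)),
    A (m ∘ s) = ((Equiv.Perm.sign s : ℤ) : ℝ) * A m

lemma IsForm.eq_zero_of_eq {n : ℕ} {A : (Fin n → Fin 4) → ℝ} (hA : IsForm A)
    {m : Fin n → Fin 4} {i j : Fin n} (hij : i ≠ j) (hm : m i = m j) : A m = 0 := by
  have hswap : m ∘ Equiv.swap i j = m := by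
    rw [Equiv.comp_swap_eq_update, hm, Function.update_eq_self, ← hm, Function.update_eq_self]
  have hneg := hA m (Equiv.swap i j)
  rw [hswap, Equiv.Perm.sign_swap hij] at hneg
  push_cast at hneg
  linarith

lemma abs_etaDiag (μ : Fin 4) : |etaDiag μ| = 1 := by
  cases μ using Fin.cases <;> simp

lemma abs_eta_le_one (μ ν : Fin 4) : |eta μ ν| ≤ 1 := by
  rw [eta]
  split_ifs
  · exact (abs_etaDiag μ).le
  · simp

lemma abs_prod_etaDiag {n : ℕ} (m : Fin n → Fin 4) : |∏ i, etaDiag (m i)| = 1 := by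
  rw [Finset.abs_prod, Finset.prod_eq_one fun i _ => abs_etaDiag (m i)]

lemma prod_etaDiag_eq_one {n : ℕ} {m : Fin n → Fin 4} (hm : ∀ i, m i ≠ 0) :
    ∏ i, etaDiag (m i) = 1 :=
  Finset.prod_eq_one fun i _ => by
    obtain ⟨a, ha⟩ := Fin.exists_succ_eq.2 (hm i)
    rw [← ha, etaDiag_succ]

lemma one_le_prod_etaDiag_add {n : ℕ} (m : Fin n → Fin 4) :
    1 ≤ (∏ i, etaDiag (m i)) + 2 * ∑ i, if m i = 0 then (1 : ℝ) else 0 := by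
  by_cases hm : ∀ i, m i ≠ 0
  · simp [prod_etaDiag_eq_one hm, hm]
  · push Not at hm
    obtain ⟨i, hi⟩ := hm
    have hcount : 1 ≤ ∑ i, if m i = 0 then (1 : ℝ) else 0 := by
      simpa only [hi, if_true] using Finset.single_le_sum
        (f := fun i => if m i = 0 then (1 : ℝ) else 0)
        (fun i _ => by positivity) (Finset.mem_univ i)
    linarith [neg_le_of_abs_le (abs_prod_etaDiag m).le]

lemma sum_eq_sum_cons {q : ℕ} (f : (Fin (q + 1) → Fin 4) → ℝ) :
    ∑ m, f m = ∑ μ, ∑ n : Fin q → Fin 4, f (Fin.cons μ n) := by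
  rw [← (Fin.consEquiv fun _ => Fin 4).sum_comp, Fintype.sum_prod_type]
  rfl

variable {q : ℕ}

lemma IsForm.sum_ite_sq {A : (Fin (q + 1) → Fin 4) → ℝ} (hA : IsForm A) (i : Fin (q + 1)) :
    ∑ m, (if m i = 0 then A m ^ 2 else 0) = ∑ n : Fin q → Fin 4, A (Fin.cons 0 n) ^ 2 := by
  have hswap (m) : A (m ∘ Equiv.swap 0 i) ^ 2 = A m ^ 2 := by
    rw [hA, mul_pow, ← Int.cast_pow, ← Units.val_pow_eq_pow_val, Int.units_sq]
    simp
  calc ∑ m, (if m i = 0 then A m ^ 2 else 0)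
      = ∑ m : Fin (q + 1) → Fin 4, if m 0 = 0 then A m ^ 2 else 0 :=
        Fintype.sum_equiv ((Equiv.swap 0 i).arrowCongr (Equiv.refl _)) _ _ fun m => by
          simp [Equiv.arrowCongr, ← hswap m]
    _ = _ := by simp [sum_eq_sum_cons, Fin.sum_univ_succ (n := 3)]

lemma IsForm.sum_prod_etaDiag_mul_sq_cons_zero {A : (Fin (q + 1) → Fin 4) → ℝ} (hA : IsForm A) :
    ∑ n : Fin q → Fin 4, (∏ i, etaDiag (n i)) * A (Fin.cons 0 n) ^ 2
      = ∑ n : Fin q → Fin 4, A (Fin.cons 0 n) ^ 2 :=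
  Finset.sum_congr rfl fun n _ => by
    by_cases hn : ∀ i, n i ≠ 0
    · rw [prod_etaDiag_eq_one hn, one_mul]
    · push Not at hn
      obtain ⟨i, hi⟩ := hn
      rw [hA.eq_zero_of_eq (m := Fin.cons 0 n) (Fin.succ_ne_zero i) (by simpa using hi)]
      ring

variable (P : ℝ → (Fin (q + 1) → Fin 4) → ℝ) {t : ℝ}

lemma two_mul_factorial_mul_formT_zero_zero (t : ℝ) :
    2 * (q + 1).factorial * formT P t 0 0 = (∑ m, (∏ i, etaDiag (m i)) * P t m ^ 2)
      + 2 * (q + 1) * ∑ n : Fin q → Fin 4, (∏ i, etaDiag (n i)) * P t (Fin.cons 0 n) ^ 2 := by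
  have hq : (q.factorial : ℝ) ≠ 0 := Nat.cast_ne_zero.2 q.factorial_ne_zero
  simp only [formT, eta_zero_zero, Nat.factorial_succ, ← sq]
  push_cast
  field_simp
  ring

lemma factorial_mul_trace_formT (t : ℝ) :
    (q + 1).factorial * ∑ μ, etaDiag μ * formT P t μ μ =
      (q - 1) * ∑ m, (∏ i, etaDiag (m i)) * P t m ^ 2 := by
  have hq : (q.factorial : ℝ) ≠ 0 := Nat.cast_ne_zero.2 q.factorial_ne_zero
  have hterm (μ) : etaDiag μ * formT P t μ μ = (∑ n : Fin q → Fin 4,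
        (∏ i, etaDiag ((Fin.cons μ n : Fin (q + 1) → Fin 4) i)) * P t (Fin.cons μ n) ^ 2) /
          q.factorial
      - (∑ m, (∏ i, etaDiag (m i)) * P t m ^ 2) / (2 * (q + 1).factorial) := by
    simp only [formT, eta, if_true, Fin.prod_univ_succ, Fin.cons_zero, Fin.cons_succ, mul_assoc,
      ← Finset.mul_sum, ← sq]
    linear_combination (-(∑ m : Fin (q + 1) → Fin 4, etaDiag (m 0) *
      ((∏ i : Fin q, etaDiag (m i.succ)) * P t m ^ 2)) / (2 * (q + 1).factorial))
      * etaDiag_mul_self μ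
  simp only [hterm, Finset.sum_sub_distrib, ← Finset.sum_div, ← sum_eq_sum_cons fun m =>
    (∏ i, etaDiag (m i)) * P t m ^ 2, Finset.sum_const, Finset.card_univ, Fintype.card_fin,
    nsmul_eq_mul, Nat.factorial_succ]
  push_cast
  field_simp
  ring

variable {P}

lemma abs_sum_prod_etaDiag_mul_sq_le {n : ℕ} (A : (Fin n → Fin 4) → ℝ) :
    |∑ m, (∏ i, etaDiag (m i)) * A m ^ 2| ≤ ∑ m, A m ^ 2 := by
  refine (Finset.abs_sum_le_sum_abs _ _).trans_eq ?_
  simp only [abs_mul, abs_prod_etaDiag, one_mul, abs_sq]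

lemma abs_sum_prod_etaDiag_mul_cons_le (A : (Fin (q + 1) → Fin 4) → ℝ) (μ ν : Fin 4) :
    |∑ n : Fin q → Fin 4, (∏ i, etaDiag (n i)) * (A (Fin.cons μ n) * A (Fin.cons ν n))|
      ≤ ∑ m, A m ^ 2 := by
  have hle (μ) : ∑ n : Fin q → Fin 4, A (Fin.cons μ n) ^ 2 ≤ ∑ m, A m ^ 2 := by
    rw [sum_eq_sum_cons fun m => A m ^ 2]
    exact Finset.single_le_sum (f := fun μ => ∑ n : Fin q → Fin 4, A (Fin.cons μ n) ^ 2)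
      (fun μ _ => by positivity) (Finset.mem_univ μ)
  calc |∑ n : Fin q → Fin 4, (∏ i, etaDiag (n i)) * (A (Fin.cons μ n) * A (Fin.cons ν n))|
      ≤ ∑ n : Fin q → Fin 4, (A (Fin.cons μ n) ^ 2 + A (Fin.cons ν n) ^ 2) / 2 := by
        refine (Finset.abs_sum_le_sum_abs _ _).trans (Finset.sum_le_sum fun n _ => ?_)
        rw [abs_mul, abs_prod_etaDiag, one_mul]
        exact abs_mul_le_half_add_sq _ _
    _ ≤ ∑ m, A m ^ 2 := by
        rw [← Finset.sum_div, Finset.sum_add_distrib]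
        linarith [hle μ, hle ν]

lemma IsForm.sum_sq_le (hP : IsForm (P t)) :
    ∑ m, P t m ^ 2 ≤ 2 * (q + 1).factorial * formT P t 0 0 := by
  have hcount : ∑ m, (∑ i, if m i = 0 then (1 : ℝ) else 0) * P t m ^ 2 =
      (q + 1) * ∑ n : Fin q → Fin 4, P t (Fin.cons 0 n) ^ 2 := by
    simp only [Finset.sum_mul, ite_mul, one_mul, zero_mul]
    rw [Finset.sum_comm]
    simp only [hP.sum_ite_sq, Finset.sum_const, Finset.card_univ, Fintype.card_fin, nsmul_eq_mul]
    push_cast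
    rfl
  rw [two_mul_factorial_mul_formT_zero_zero, hP.sum_prod_etaDiag_mul_sq_cons_zero, mul_assoc,
    ← hcount, Finset.mul_sum, ← Finset.sum_add_distrib]
  refine Finset.sum_le_sum fun m _ => ?_
  linear_combination P t m ^ 2 * one_le_prod_etaDiag_add m

lemma IsForm.abs_formT_le (hP : IsForm (P t)) (μ ν : Fin 4) :
    |formT P t μ ν| ≤ (2 * q + 3) * formT P t 0 0 := by
  have hpos : (0 : ℝ) < 2 * (q + 1).factorial := by positivity
  have hfactor : formT P t μ ν * (2 * (q + 1).factorial) = 2 * (q + 1) * (∑ n : Fin q → Fin 4,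
        (∏ i, etaDiag (n i)) * (P t (Fin.cons μ n) * P t (Fin.cons ν n)))
      - eta μ ν * ∑ m, (∏ i, etaDiag (m i)) * P t m ^ 2 := by
    rw [formT, Nat.factorial_succ]
    push_cast
    field_simp
  have htrace : |eta μ ν * ∑ m, (∏ i, etaDiag (m i)) * P t m ^ 2| ≤ ∑ m, P t m ^ 2 := by
    rw [abs_mul]
    exact (mul_le_of_le_one_left (abs_nonneg _) (abs_eta_le_one μ ν)).trans
      (abs_sum_prod_etaDiag_mul_sq_le _)
  refine le_of_mul_le_mul_right ?_ hpos
  calc |formT P t μ ν| * (2 * (q + 1).factorial)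
      = |formT P t μ ν * (2 * (q + 1).factorial)| := by rw [abs_mul, abs_of_pos hpos]
    _ ≤ 2 * (q + 1) * (∑ m, P t m ^ 2) + ∑ m, P t m ^ 2 := by
        rw [hfactor]
        refine (abs_sub _ _).trans (add_le_add ?_ htrace)
        rw [abs_mul, abs_of_nonneg (by positivity)]
        exact mul_le_mul_of_nonneg_left (abs_sum_prod_etaDiag_mul_cons_le _ μ ν) (by positivity)
    _ ≤ (2 * q + 3) * formT P t 0 0 * (2 * (q + 1).factorial) := by
        linear_combination (2 * q + 3) * hP.sum_sq_le

lemma IsForm.energyConditions (hq : q ≤ 2) (hP : IsForm (P t)) :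
    EnergyConditions 1 (2 * q + 3) (formT P t) := by
  have henergy := hP.sum_sq_le
  refine ⟨?_, hP.abs_formT_le, ?_⟩
  · exact nonneg_of_mul_nonneg_right ((by positivity : (0 : ℝ) ≤ _).trans henergy) (by positivity)
  · have hq_abs : |(q : ℝ) - 1| ≤ 1 := by
      have : (q : ℝ) ≤ 2 := by exact_mod_cast hq
      exact abs_le.2 ⟨by linarith [q.cast_nonneg (α := ℝ)], by linarith⟩
    have htrace : |(q - 1) * ∑ m, (∏ i, etaDiag (m i)) * P t m ^ 2|
        ≤ 2 * (q + 1).factorial * formT P t 0 0 := by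
      rw [abs_mul]
      exact (mul_le_of_le_one_left (abs_nonneg _) hq_abs).trans
        ((abs_sum_prod_etaDiag_mul_sq_le _).trans henergy)
    refine le_of_mul_le_mul_left ?_ (by positivity : (0 : ℝ) < 2 * (q + 1).factorial)
    linear_combination neg_le_of_abs_le htrace - factorial_mul_trace_formT P t

end FormField

section PerfectFluid

variable {γ : ℝ} {ρ : ℝ → ℝ} {U : ℝ → Fin 4 → ℝ} {t : ℝ}

lemma etaDiag_mul_sq (μ : Fin 4) (x : ℝ) : (etaDiag μ * x) ^ 2 = x ^ 2 := by
  rw [mul_pow, sq (etaDiag μ), etaDiag_mul_self, one_mul]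

lemma sq_zero_eq_one_add (hU : ∑ μ, etaDiag μ * U t μ ^ 2 = -1) :
    U t 0 ^ 2 = 1 + ∑ a : Fin 3, U t a.succ ^ 2 := by
  rw [Fin.sum_univ_succ] at hU
  simp only [etaDiag_zero, etaDiag_succ, neg_mul, one_mul] at hU
  linarith

lemma sq_le_sq_zero (hU : ∑ μ, etaDiag μ * U t μ ^ 2 = -1) (μ : Fin 4) :
    U t μ ^ 2 ≤ U t 0 ^ 2 := by
  cases μ using Fin.cases with
  | zero => exact le_rfl
  | succ a =>
    rw [sq_zero_eq_one_add hU]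
    exact (Finset.single_le_sum (f := fun a : Fin 3 => U t a.succ ^ 2) (fun a _ => sq_nonneg _)
      (Finset.mem_univ a)).trans (le_add_of_nonneg_left zero_le_one)

lemma fluidT_zero_zero : fluidT γ ρ U t 0 0 = ρ t * (1 + γ * (U t 0 ^ 2 - 1)) := by
  rw [fluidT, eta_zero_zero, etaDiag_zero]
  ring

lemma trace_fluidT (hU : ∑ μ, etaDiag μ * U t μ ^ 2 = -1) :
    ∑ μ, etaDiag μ * fluidT γ ρ U t μ μ = (3 * γ - 4) * ρ t := by
  have hterm (μ) : etaDiag μ * fluidT γ ρ U t μ μ =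
      γ * ρ t * (etaDiag μ * U t μ ^ 2) + (γ - 1) * ρ t := by
    rw [fluidT, eta, if_pos rfl]
    linear_combination (γ * ρ t * etaDiag μ * U t μ ^ 2 + (γ - 1) * ρ t) * etaDiag_mul_self μ
  simp only [hterm, Finset.sum_add_distrib, ← Finset.mul_sum, hU, Finset.sum_const,
    Finset.card_univ, Fintype.card_fin, nsmul_eq_mul]
  push_cast
  ring

lemma abs_fluidT_le (hγ : 0 ≤ γ) (hρ : 0 ≤ ρ t) (hU : ∑ μ, etaDiag μ * U t μ ^ 2 = -1)
    (μ ν : Fin 4) : |fluidT γ ρ U t μ ν| ≤ (2 + 2 * γ) * fluidT γ ρ U t 0 0 := by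
  have hU₀ : 1 ≤ U t 0 ^ 2 := by
    rw [sq_zero_eq_one_add hU]
    exact le_add_of_nonneg_right (by positivity)
  have hflux : |(etaDiag μ * U t μ) * (etaDiag ν * U t ν)| ≤ U t 0 ^ 2 := by
    refine (abs_mul_le_half_add_sq _ _).trans ?_
    rw [etaDiag_mul_sq, etaDiag_mul_sq]
    linarith [sq_le_sq_zero hU μ, sq_le_sq_zero hU ν]
  have hpressure : |(γ - 1) * eta μ ν| ≤ γ + 1 := by
    rw [abs_mul]
    exact (mul_le_of_le_one_right (abs_nonneg _) (abs_eta_le_one μ ν)).trans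
      (abs_le.2 ⟨by linarith, by linarith⟩)
  calc |fluidT γ ρ U t μ ν|
      = ρ t * |γ * ((etaDiag μ * U t μ) * (etaDiag ν * U t ν)) + (γ - 1) * eta μ ν| := by
        rw [show fluidT γ ρ U t μ ν = ρ t * (γ * ((etaDiag μ * U t μ) * (etaDiag ν * U t ν))
          + (γ - 1) * eta μ ν) by rw [fluidT]; ring, abs_mul, abs_of_nonneg hρ]
    _ ≤ ρ t * (γ * U t 0 ^ 2 + (γ + 1)) := by
        refine mul_le_mul_of_nonneg_left ((abs_add_le _ _).trans (add_le_add ?_ hpressure)) hρ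
        rw [abs_mul, abs_of_nonneg hγ]
        exact mul_le_mul_of_nonneg_left hflux hγ
    _ ≤ ρ t * ((2 + 2 * γ) * (1 + γ * (U t 0 ^ 2 - 1))) := by
        refine mul_le_mul_of_nonneg_left ?_ hρ
        have hγU : 0 ≤ γ * (U t 0 ^ 2 - 1) := mul_nonneg hγ (sub_nonneg.2 hU₀)
        linear_combination hγU + 2 * γ * hγU
    _ = (2 + 2 * γ) * fluidT γ ρ U t 0 0 := by rw [fluidT_zero_zero]; ring

lemma energyConditions_fluidT (hγ : 0 ≤ γ) (hρ : 0 ≤ ρ t)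
    (hU : ∑ μ, etaDiag μ * U t μ ^ 2 = -1) :
    EnergyConditions (min 1 (3 * γ / 2)) (2 + 2 * γ) (fluidT γ ρ U t) := by
  have hU₀ : 0 ≤ U t 0 ^ 2 - 1 := by
    rw [sq_zero_eq_one_add hU, add_sub_cancel_left]
    positivity
  refine ⟨?_, abs_fluidT_le hγ hρ hU, ?_⟩
  · rw [fluidT_zero_zero]
    positivity
  · rw [trace_fluidT hU, fluidT_zero_zero]
    have hγU : 0 ≤ ρ t * (γ * (U t 0 ^ 2 - 1)) := by positivity
    linear_combination ρ t * min_le_right 1 (3 * γ / 2)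
      + (ρ t * (γ * (U t 0 ^ 2 - 1))) * min_le_left 1 (3 * γ / 2) + hγU

lemma fluidT_of_zero (ρ : ℝ → ℝ) (U : ℝ → Fin 4 → ℝ) (t : ℝ) (μ ν : Fin 4) :
    fluidT 0 ρ U t μ ν = -(ρ t * eta μ ν) := by
  simp [fluidT]

lemma deriv_density_eq_zero {e : ℝ → Module.Basis (Fin 3) ℝ 𝔤}
    (hdiv : divergence e (n := 1) (fun s i => fluidT 0 ρ U s (i 0) (i 1)) t ![0] = 0) :
    deriv ρ t = 0 := by
  simp only [divergence, covDeriv, fluidT_of_zero] at hdiv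
  rw [Fin.sum_univ_succ] at hdiv
  simpa [Fin.sum_univ_succ (n := 3), Fin.sum_univ_two, eta] using hdiv

end PerfectFluid

section VacuumFluid

variable {e : ℝ → Module.Basis (Fin 3) ℝ 𝔤}
  {ρ : ℝ → ℝ} {U : ℝ → Fin 4 → ℝ}

lemma exists_density_eq {t₀ : ℝ} (hρ : DifferentiableOn ℝ ρ (Set.Ioi t₀))
    (hdiv : ∀ t > t₀, divergence e (n := 1) (fun s i => fluidT 0 ρ U s (i 0) (i 1)) t ![0] = 0) :
    ∃ ρ₀, ∀ t > t₀, ρ t = ρ₀ :=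
  ⟨ρ (t₀ + 1), fun _ ht => isOpen_Ioi.is_const_of_deriv_eq_zero isPreconnected_Ioi hρ
    (fun s hs => deriv_density_eq_zero (hdiv s hs)) ht (lt_add_one t₀)⟩

lemma omegaLambda_add_omegaFluid_zero (Λ t : ℝ) :
    omegaLambda Λ e t + omegaFluid 0 ρ U e t = omegaLambda (Λ + ρ t) e t := by
  rw [omegaLambda, omegaFluid, omegaLambda, fluidT_of_zero, eta_zero_zero, ← add_div]
  ring

end VacuumFluid

end Bianchi

open Bianchi in
theorem theorem1_general {𝔤 : Type*} [LieRing 𝔤] [LieAlgebra ℝ 𝔤] {q : ℕ} (hq : q ≤ 2)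
    (γ Λ t₀ : ℝ) (hγ : 0 ≤ γ) (hΛ : 0 < Λ)
    (e : ℝ → Module.Basis (Fin 3) ℝ 𝔤) (P : ℝ → (Fin (q + 1) → Fin 4) → ℝ)
    (ρ : ℝ → ℝ) (U : ℝ → Fin 4 → ℝ)
    (hframe : ∀ t > t₀, FrameContDiffAt e t)
    (hscalar : ∀ t > t₀, spatialScalar (spaceCoeff e t) ≤ 0)
    (hform : ∀ t > t₀, IsForm (P t))
    (hρ_diff : DifferentiableOn ℝ ρ (Set.Ioi t₀))
    (hρ_nonneg : ∀ t > t₀, 0 ≤ ρ t)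
    (hunit : ∀ t > t₀, ∑ μ, etaDiag μ * U t μ ^ 2 = -1)
    (hfluid : ∀ t > t₀, ∀ m, divergence e (n := 1) (fun s i => fluidT γ ρ U s (i 0) (i 1)) t m = 0)
    (heinstein : ∀ t > t₀, ∀ μ ν,
      einstein e t μ ν = fluidT γ ρ U t μ ν + formT P t μ ν - Λ * eta μ ν) :
    AsymptoticallyDeSitter e ∧ (0 < γ → Tendsto (omegaLambda Λ e) atTop (𝓝 1)) ∧
    (γ = 0 → Tendsto (fun t => omegaLambda Λ e t + omegaFluid γ ρ U e t) atTop (𝓝 1)) := by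
  have hform_energy (t) (ht : t > t₀) := (hform t ht).energyConditions hq
  rcases hγ.eq_or_lt with rfl | hγ
  -- The stress tensor of a fluid with `p = -ρ` is a cosmological constant.
  · obtain ⟨ρ₀, hρ₀⟩ := exists_density_eq hρ_diff fun t ht => hfluid t ht ![0]
    have hρ₀_nonneg : 0 ≤ ρ₀ := hρ₀ (t₀ + 1) (lt_add_one t₀) ▸ hρ_nonneg _ (lt_add_one t₀)
    have hM : IsWaldModel (Λ + ρ₀) 1 (2 * q + 3) t₀ e (formT P) :=
      ⟨hframe, hscalar, hform_energy, fun t ht μ ν => by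
        rw [heinstein t ht, fluidT_of_zero, hρ₀ t ht]
        ring⟩
    obtain ⟨hdS, hΩ⟩ := hM.asymptoticallyDeSitter (by positivity) one_pos le_rfl
    refine ⟨hdS, fun h => absurd h (lt_irrefl 0), fun _ => hΩ.congr' ?_⟩
    filter_upwards [eventually_gt_atTop t₀] with t ht
    rw [omegaLambda_add_omegaFluid_zero, hρ₀ t ht]
  · have hM : IsWaldModel Λ _ _ t₀ e fun t μ ν => fluidT γ ρ U t μ ν + formT P t μ ν :=
      ⟨hframe, hscalar, fun t ht => (energyConditions_fluidT hγ.le (hρ_nonneg t ht)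
        (hunit t ht)).add (hform_energy t ht), heinstein⟩
    obtain ⟨hdS, hΩ⟩ := hM.asymptoticallyDeSitter hΛ (by positivity) (min_le_right _ _)
    exact ⟨hdS, fun _ => hΩ, fun h => absurd h hγ.ne'⟩

/-- Bianchi types I–VII_h are the three-dimensional real solvable Lie algebras. The form field has
degree `j = q + 1 ∈ {1, 3}`. -/
theorem theorem1 {𝔤 : Type*} [LieRing 𝔤] [LieAlgebra ℝ 𝔤] [LieAlgebra.IsSolvable 𝔤]
    {q : ℕ} (hj : q + 1 = 1 ∨ q + 1 = 3)
    (γ Λ t₀ : ℝ) (hγ : 0 ≤ γ) (hΛ : 0 < Λ)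
    (e : ℝ → Module.Basis (Fin 3) ℝ 𝔤) (P : ℝ → (Fin (q + 1) → Fin 4) → ℝ)
    (ρ : ℝ → ℝ) (U : ℝ → Fin 4 → ℝ)
    (hsol : Bianchi.IsCosmology γ Λ t₀ e P ρ U) :
    Bianchi.AsymptoticallyDeSitter e ∧
    (0 < γ → Tendsto (Bianchi.omegaLambda Λ e) atTop (𝓝 1)) ∧
    (γ = 0 → Tendsto (fun t => Bianchi.omegaLambda Λ e t + Bianchi.omegaFluid γ ρ U e t)
      atTop (𝓝 1)) :=
  theorem1_general (by omega) γ Λ t₀ hγ hΛ e P ρ U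
    (fun t ht φ a => (hsol.frame_contDiff φ a).contDiffAt (Ioi_mem_nhds ht))
    (fun t _ => Bianchi.spatialScalar_spaceCoeff_nonpos e t) hsol.form_alternating
    (hsol.density_contDiff.differentiableOn one_ne_zero) hsol.density_nonneg hsol.velocity_unit
    hsol.fluid_conserved hsol.einstein_eq
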